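/- Let $d\ge 0$, $n\ge 3$, $k\in\mathbb Z^d$, $\gamma>0$, and $\mathbb T^d=(\mathbb R/2\pi\mathbb Z)^d$ with Lebesgue measure of total mass $(2\pi)^d$. Let $\sigma_1:\mathbb T^d\to[0,\infty)$ be $C^\infty$ and even ($\sigma_1(-x)=\sigma_1(x)$, as is the case when $\sigma_1$ is radially symmetric) with $\int_{\mathbb T^d}\sigma_1\,dx\ne0$, and let $\sigma_2:\mathbb R^n\to[0,\infty)$ be $C^\infty$, radially symmetric and compactly supported, with $(-\Delta)^{-1/2}\sigma_2\in L^2(\mathbb R^n)$ and $\widehat\sigma_2(\xi)\neq0$ for all $\xi\in\mathbb R^n$. Put $$\sigma_{1,m}=\frac1{(2\pi)^d}\int_{\mathbb T^d}\sigma_1(x)e^{-im\cdot x}\,dx\quad(m\in\mathbb Z^d),\qquad \kappa=\int_{\mathbb R^n}\frac{|\widehat\sigma_2(\xi)|^2}{|\xi|^2}\frac{d\xi}{(2\pi)^n},\qquad \widehat\sigma_2(\xi)=\int_{\mathbb R^n}\sigma_2(z)e^{-i\xi\cdot z}\,dz,$$ and assume the smallness condition $4\gamma^2\kappa\|\sigma_1\|_{L^1(\mathbb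 T^d)}^2<1$. On the complex Hilbert space $\mathscr V=L^2(\mathbb T^d)\times L^2(\mathbb T^d)\times L^2(\mathbb T^d;L^2(\mathbb R^n))\times L^2(\mathbb T^d;L^2(\mathbb R^n))$ consider the unbounded operator $\mathscr L$ with domain $D(\mathscr L)=H^2(\mathbb T^d)\times H^2(\mathbb T^d)\times L^2(\mathbb T^d;L^2(\mathbb R^n))\times L^2(\mathbb T^d;L^2(\mathbb R^n))$ given by $$\mathscr L\begin{pmatrix}q\\p\\\phi\\\pi\end{pmatrix}=\begin{pmatrix}-\frac12\Delta_xq+k\cdot\nabla_xp+\gamma\,\sigma_1\star\int_{\mathbb R^n}\big((-\Delta)^{-1/2}\sigma_2\big)\phi\,dz\\[2pt]-\frac12\Delta_xp-k\cdot\nabla_xq\\[2pt]\frac12\phi+\gamma\,\big((-\Delta)^{-1/2}\sigma_2\big)\,\sigma_1\star q\\[2pt]\frac12\pi\end{pmatrix}.$$ Write $m^2=\sum_jm_j^2$ and $m^4=(m^2)^2$. The essential spectrum is the set of points of the spectrum that are not isolated eigenvalues of finite multiplicity. Then: 1. $\sigma_{\mathrm{ess}}(\mathscr L)=\{1/2\}$.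 2. $\mathscr L$ has finitely many negative eigenvalues, each with a finite-dimensional eigenspace, and their number $n(\mathscr L)$, counted with multiplicity, is $$n(\mathscr L)=1+\#\{m\in\mathbb Z^d\setminus\{0\}: m^4-4(k\cdot m)^2<0,\ \sigma_{1,m}=0\}+\#\{m\in\mathbb Z^d\setminus\{0\}: m^4-4(k\cdot m)^2\le0,\ \sigma_{1,m}\ne0\},$$ where both sets are finite. In particular $n(\mathscr L)=1$ when $k=0$. 3. With $X_0=(0,\mathbf 1,0,0)$, $\mathrm{span}_{\mathbb R}\{X_0\}\subset\mathrm{Ker}(\mathscr L)$. Moreover, with $\mathscr K_*=\{m\in\mathbb Z^d\setminus\{0\}: m^4-4(k\cdot m)^2=0,\ \sigma_{1,m}=0\}$, which is finite, $\mathrm{Ker}(\mathscr L)$ is finite-dimensional over $\mathbb C$ and $\dim\mathrm{Ker}(\mathscr L)=1+\#\mathscr K_*$. -/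

import Mathlib

open MeasureTheory
open scoped FourierTransform ContDiff

noncomputable section

namespace SchrodingerWave

instance factTwoPiPos : Fact (0 < 2 * Real.pi) := ⟨Real.two_pi_pos⟩

/-! ### Spectral notions for unbounded operators -/

section Spectral

variable {V : Type*} [NormedAddCommGroup V] [NormedSpace ℂ V]

/-- The eigenspace `Ker (A - μ)`, a subspace of the domain of `A`, seen inside `V`. -/
def eigenspace (A : V →ₗ.[ℂ] V) (μ : ℂ) : Submodule ℂ V :=
  (LinearMap.ker (A.toFun - μ • A.domain.subtype)).map A.domain.subtype

/-- The resolvent set: `A - μ` is a bijection from the domain of `A` onto `V` with a bounded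
inverse `R`. -/
def resolventSet (A : V →ₗ.[ℂ] V) : Set ℂ :=
  {μ | ∃ R : V →L[ℂ] V,
    (∀ y : V, ∃ h : R y ∈ A.domain, A ⟨R y, h⟩ - μ • R y = y) ∧
    ∀ x : A.domain, R (A x - μ • (x : V)) = x}

/-- The spectrum of an unbounded operator. -/
def unboundedSpectrum (A : V →ₗ.[ℂ] V) : Set ℂ := (resolventSet A)ᶜ

/-- The essential spectrum of a self-adjoint operator: the points of the spectrum which are not
isolated eigenvalues of finite multiplicity. -/
def essentialSpectrum (A : V →ₗ.[ℂ] V) : Set ℂ :=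
  {μ | μ ∈ unboundedSpectrum A ∧
    ¬ ((∃ ε > 0, ∀ ν ∈ unboundedSpectrum A, ‖ν - μ‖ < ε → ν = μ) ∧
        eigenspace A μ ≠ ⊥ ∧ FiniteDimensional ℂ (eigenspace A μ))}

/-- The negative eigenvalues of `A`. -/
def negativeEigenvalues (A : V →ₗ.[ℂ] V) : Set ℝ :=
  {μ | μ < 0 ∧ eigenspace A (μ : ℂ) ≠ ⊥}

/-- The number of negative eigenvalues of `A`, counted with multiplicity (meaningful when there are
finitely many of them and their eigenspaces are finite dimensional). -/
def negativeIndex (A : V →ₗ.[ℂ] V) : ℕ :=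
  ∑ᶠ μ ∈ negativeEigenvalues A, Module.finrank ℂ (eigenspace A (μ : ℂ))

end Spectral

/-! ### Function spaces -/

/-- The torus `(ℝ / 2πℤ)^d`; its `volume` is the Lebesgue measure, of total mass `(2π)^d`. -/
abbrev Torus (d : ℕ) : Type := Fin d → AddCircle (2 * Real.pi)

/-- `L²(𝕋^d; ℂ)`. -/
abbrev L2Torus (d : ℕ) : Type := Lp ℂ 2 (volume : Measure (Torus d))

/-- `L²(ℝ^n; ℂ)`. -/
abbrev L2Space (n : ℕ) : Type := Lp ℂ 2 (volume : Measure (EuclideanSpace ℝ (Fin n)))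

/-- `L²(𝕋^d; L²(ℝ^n; ℂ))`. -/
abbrev L2Field (d n : ℕ) : Type := Lp (L2Space n) 2 (volume : Measure (Torus d))

/-- The Hilbert space `L²(𝕋^d) × L²(𝕋^d) × L²(𝕋^d; L²(ℝ^n)) × L²(𝕋^d; L²(ℝ^n))`; its elements
`((q, p), (φ, π))` are the unknowns. -/
abbrev StateSpace (d n : ℕ) : Type :=
  WithLp 2 (WithLp 2 (L2Torus d × L2Torus d) × WithLp 2 (L2Field d n × L2Field d n))

/-! ### Fourier series on the torus -/

/-- The character `x ↦ exp (i m · x)`. -/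
def character {d : ℕ} (m : Fin d → ℤ) : C(Torus d, ℂ) where
  toFun x := ∏ j, fourier (m j) (x j)
  continuous_toFun := by fun_prop

/-- The character `x ↦ exp (i m · x)` as an element of `L²(𝕋^d)`. -/
def characterL2 {d : ℕ} (m : Fin d → ℤ) : L2Torus d :=
  ContinuousMap.toLp 2 volume ℂ (character m)

/-- The Fourier coefficient `f_m = (2π)^{-d} ∫ f(x) exp (-i m · x) dx`. -/
def coeff {d : ℕ} (f : Torus d → ℂ) (m : Fin d → ℤ) : ℂ :=
  ((2 * Real.pi : ℂ) ^ d)⁻¹ * ∫ x, f x * character (-m) x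

theorem integrable_mul_character {d : ℕ} (q : L2Torus d) (m : Fin d → ℤ) :
    Integrable (fun x => q x * character m x) volume := by
  have h2 : MemLp (fun x : Torus d => character m x) 2 volume :=
    (character m).continuous.memLp_of_hasCompactSupport (HasCompactSupport.of_compactSpace _)
  exact (Lp.memLp q).integrable_mul h2

theorem coeff_add {d : ℕ} (q r : L2Torus d) (m : Fin d → ℤ) :
    coeff (q + r : L2Torus d) m = coeff q m + coeff r m := by
  unfold coeff
  rw [← mul_add, ← integral_add (integrable_mul_character q _) (integrable_mul_character r _)]
  congr 1
  apply integral_congr_ae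
  filter_upwards [Lp.coeFn_add q r] with x hx
  rw [hx, Pi.add_apply, add_mul]

theorem coeff_smul {d : ℕ} (a : ℂ) (q : L2Torus d) (m : Fin d → ℤ) :
    coeff (a • q : L2Torus d) m = a * coeff q m := by
  have h : ∫ x, (a • q : L2Torus d) x * character (-m) x = a * ∫ x, q x * character (-m) x := by
    rw [← integral_const_mul]
    apply integral_congr_ae
    filter_upwards [Lp.coeFn_smul a q] with x hx
    rw [hx, Pi.smul_apply, smul_eq_mul, mul_assoc]
  unfold coeff
  rw [h, mul_left_comm]

theorem character_inner_fourier (a b : ℤ) :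
    ∫ x : AddCircle (2 * Real.pi), fourier (-a) x * fourier b x
      = if a = b then ((2 * Real.pi : ℝ) : ℂ) else 0 := by
  have h := (orthonormal_iff_ite.mp (orthonormal_fourier (T := 2 * Real.pi))) a b
  rw [ContinuousMap.inner_toLp] at h
  rw [AddCircle.volume_eq_smul_haarAddCircle, integral_smul_measure,
    ENNReal.toReal_ofReal Real.two_pi_pos.le]
  have h2 : ∫ x : AddCircle (2 * Real.pi), fourier (-a) x * fourier b x ∂AddCircle.haarAddCircle
      = if a = b then 1 else 0 := by
    rw [← h]
    congr 1
    ext x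
    rw [fourier_neg, mul_comm]
  rw [h2]
  split_ifs <;> simp

/-- The characters are pairwise orthogonal in `L²(𝕋^d)`, with squared norm `(2π)^d`. -/
theorem inner_characterL2 {d : ℕ} (m l : Fin d → ℤ) :
    inner ℂ (characterL2 m) (characterL2 l)
      = if m = l then ((2 * Real.pi : ℝ) : ℂ) ^ d else 0 := by
  unfold characterL2
  rw [ContinuousMap.inner_toLp]
  have h1 : ∀ x : Torus d, character l x * (starRingEnd ℂ) (character m x)
      = ∏ j, (fourier (-m j) (x j) * fourier (l j) (x j)) := by
    intro x
    simp only [character, ContinuousMap.coe_mk, map_prod, fourier_neg, Finset.prod_mul_distrib]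
    rw [mul_comm]
  simp_rw [h1]
  rw [integral_fintype_prod_volume_eq_prod
    (f := fun j (y : AddCircle (2 * Real.pi)) => fourier (-m j) y * fourier (l j) y)]
  simp_rw [character_inner_fourier]
  split_ifs with h
  · subst h
    simp
  · obtain ⟨i, hi⟩ := Function.ne_iff.mp h
    exact Finset.prod_eq_zero (Finset.mem_univ i) (by simp [hi])

/-- A series of multiples of the characters with square summable coefficients converges. -/
theorem summable_smul_characterL2 {d : ℕ} {c : (Fin d → ℤ) → ℂ}
    (hc : Summable fun m => ‖c m‖ ^ 2) : Summable fun m => c m • characterL2 m := by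
  have hs : (0 : ℝ) < Real.sqrt ((2 * Real.pi) ^ d) := Real.sqrt_pos.mpr (by positivity)
  set s : ℂ := (Real.sqrt ((2 * Real.pi) ^ d) : ℂ) with hsdef
  have hs0 : s ≠ 0 := by rw [hsdef]; exact_mod_cast hs.ne'
  have hss : s * s = ((2 * Real.pi : ℝ) : ℂ) ^ d := by
    rw [hsdef, ← Complex.ofReal_mul, Real.mul_self_sqrt (by positivity)]
    push_cast
    rfl
  have hstar : (starRingEnd ℂ) s = s := Complex.conj_ofReal _
  have ho : Orthonormal ℂ fun m : Fin d → ℤ => s⁻¹ • characterL2 m := by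
    rw [orthonormal_iff_ite]
    intro m l
    rw [inner_smul_left, inner_smul_right, inner_characterL2, map_inv₀, hstar]
    split_ifs
    · rw [← hss]
      field_simp
    · simp
  have h := (ho.orthogonalFamily.summable_iff_norm_sq_summable fun m => s * c m).mpr (by
    simp only [norm_mul, mul_pow]
    exact hc.mul_left _)
  refine h.congr fun m => ?_
  simp only [LinearIsometry.toSpanSingleton_apply, smul_smul]
  congr 1
  field_simp

/-- The Sobolev space `H²(𝕋^d)`: the `q ∈ L²(𝕋^d)` with `∑ (1 + m²)² |q_m|² < ∞`. -/
def sobolevTwo (d : ℕ) : Submodule ℂ (L2Torus d) where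
  carrier := {q | Summable fun m : Fin d → ℤ => (1 + ((m ⬝ᵥ m : ℤ) : ℝ)) ^ 2 * ‖coeff q m‖ ^ 2}
  add_mem' := by
    intro q r hq hr
    refine Summable.of_nonneg_of_le (fun m => by positivity) (fun m => ?_)
      ((hq.mul_left 2).add (hr.mul_left 2))
    rw [coeff_add]
    have h1 : ‖coeff q m + coeff r m‖ ^ 2 ≤ 2 * ‖coeff q m‖ ^ 2 + 2 * ‖coeff r m‖ ^ 2 := by
      have h2 := norm_add_le (coeff q m) (coeff r m)
      nlinarith [sq_nonneg (‖coeff q m‖ - ‖coeff r m‖), norm_nonneg (coeff q m + coeff r m)]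
    calc _ ≤ (1 + ((m ⬝ᵥ m : ℤ) : ℝ)) ^ 2 * (2 * ‖coeff q m‖ ^ 2 + 2 * ‖coeff r m‖ ^ 2) := by
          gcongr
      _ = _ := by ring
  zero_mem' := by
    have h : ∀ m : Fin d → ℤ, coeff (0 : L2Torus d) m = 0 := fun m => by
      simpa using coeff_smul 0 (0 : L2Torus d) m
    refine (summable_zero (α := ℝ)).congr fun m => ?_
    change _ = (1 + ((m ⬝ᵥ m : ℤ) : ℝ)) ^ 2 * ‖coeff (0 : L2Torus d) m‖ ^ 2
    rw [h, norm_zero]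
    ring
  smul_mem' := by
    intro a q hq
    refine (hq.mul_left (‖a‖ ^ 2)).congr fun m => ?_
    rw [coeff_smul, norm_mul]
    ring

theorem dotProduct_self_nonneg_real {d : ℕ} (m : Fin d → ℤ) : (0 : ℝ) ≤ ((m ⬝ᵥ m : ℤ) : ℝ) := by
  exact_mod_cast Finset.sum_nonneg fun j _ => mul_self_nonneg (m j)

/-- Differential operators of order at most two with constant coefficients on `H²(𝕋^d)`: if the
symbol `a` satisfies `|a m| ≤ C (1 + m²)`, this is the operator
`∑ q_m exp (i m · x) ↦ ∑ a(m) q_m exp (i m · x)`, with convergence in `L²(𝕋^d)`. -/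
def fourierMultiplier {d : ℕ} (a : (Fin d → ℤ) → ℂ)
    (ha : ∃ C : ℝ, ∀ m, ‖a m‖ ≤ C * (1 + ((m ⬝ᵥ m : ℤ) : ℝ))) :
    sobolevTwo d →ₗ[ℂ] L2Torus d :=
  have hsum : ∀ q : sobolevTwo d,
      Summable fun m => (a m * coeff (q : L2Torus d) m) • characterL2 m := by
    intro q
    obtain ⟨C, hC⟩ := ha
    refine summable_smul_characterL2 (Summable.of_nonneg_of_le (fun m => sq_nonneg _)
      (fun m => ?_) (q.2.mul_left (C ^ 2)))
    rw [norm_mul, mul_pow, ← mul_assoc, ← mul_pow C]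
    exact mul_le_mul_of_nonneg_right (pow_le_pow_left₀ (norm_nonneg _) (hC m) 2) (sq_nonneg _)
  { toFun := fun q => ∑' m, (a m * coeff (q : L2Torus d) m) • characterL2 m
    map_add' := fun q r => by
      rw [← (hsum q).tsum_add (hsum r)]
      congr 1
      ext1 m
      rw [Submodule.coe_add, coeff_add, mul_add, add_smul]
    map_smul' := fun t q => by
      rw [RingHom.id_apply, ← (hsum q).tsum_const_smul]
      congr 1
      ext1 m
      rw [Submodule.coe_smul, coeff_smul, smul_smul]
      congr 1
      ring }

/-- The Laplacian `Δ` on `H²(𝕋^d)`, of symbol `-m²`. -/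
def laplacian (d : ℕ) : sobolevTwo d →ₗ[ℂ] L2Torus d :=
  fourierMultiplier (fun m => -((m ⬝ᵥ m : ℤ) : ℂ)) ⟨1, fun m => by
    have h := dotProduct_self_nonneg_real m
    rw [norm_neg, Complex.norm_intCast, abs_of_nonneg h]
    linarith⟩

/-- The transport operator `k · ∇` on `H²(𝕋^d)`, of symbol `i k · m`. -/
def dotGradient {d : ℕ} (k : Fin d → ℤ) : sobolevTwo d →ₗ[ℂ] L2Torus d :=
  fourierMultiplier (fun m => Complex.I * ((k ⬝ᵥ m : ℤ) : ℂ)) ⟨((k ⬝ᵥ k : ℤ) : ℝ) + 1, fun m => by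
    have hk := dotProduct_self_nonneg_real k
    have hm := dotProduct_self_nonneg_real m
    rw [norm_mul, Complex.norm_I, one_mul, Complex.norm_intCast]
    have h1 : (0 : ℝ) ≤ (((k - m) ⬝ᵥ (k - m) : ℤ) : ℝ) := dotProduct_self_nonneg_real _
    have h2 : (0 : ℝ) ≤ (((k + m) ⬝ᵥ (k + m) : ℤ) : ℝ) := dotProduct_self_nonneg_real _
    simp only [sub_dotProduct, dotProduct_sub, add_dotProduct, dotProduct_add,
      dotProduct_comm m k] at h1 h2
    push_cast at h1 h2
    rw [abs_le]
    constructor <;> nlinarith [mul_nonneg hk hm]⟩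

/-! ### The coupling terms -/

theorem integrable_convolution {d : ℕ} (σ : C(Torus d, ℝ)) (q : L2Torus d) (x : Torus d) :
    Integrable (fun y => (σ (x - y) : ℂ) * q y) volume := by
  have h : Continuous fun y : Torus d => (σ (x - y) : ℂ) := by fun_prop
  have h2 : MemLp (fun y : Torus d => (σ (x - y) : ℂ)) 2 volume :=
    h.memLp_of_hasCompactSupport (HasCompactSupport.of_compactSpace _)
  exact h2.integrable_mul (Lp.memLp q)

theorem continuous_convolution {d : ℕ} (σ : C(Torus d, ℝ)) (q : L2Torus d) :
    Continuous fun x : Torus d => ∫ y, (σ (x - y) : ℂ) * q y := by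
  have hq : Integrable (fun y => q y) volume := (Lp.memLp q).integrable one_le_two
  refine continuous_of_dominated (bound := fun y => ‖σ‖ * ‖q y‖)
    (fun x => (integrable_convolution σ q x).aestronglyMeasurable) (fun x => ?_)
    (hq.norm.const_mul _) (Filter.Eventually.of_forall fun y => by fun_prop)
  refine Filter.Eventually.of_forall fun y => ?_
  rw [norm_mul, Complex.norm_real]
  exact mul_le_mul_of_nonneg_right (σ.norm_coe_le_norm _) (norm_nonneg _)

/-- The convolution `σ ⋆ q : x ↦ ∫ σ(x - y) q(y) dy` on `L²(𝕋^d)`. -/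
def convolution {d : ℕ} (σ : C(Torus d, ℝ)) : L2Torus d →ₗ[ℂ] L2Torus d where
  toFun q := ((continuous_convolution σ q).memLp_of_hasCompactSupport
    (HasCompactSupport.of_compactSpace _) : MemLp _ 2 volume).toLp
      (fun x : Torus d => ∫ y, (σ (x - y) : ℂ) * q y)
  map_add' q r := by
    rw [← MemLp.toLp_add]
    congr 1
    ext1 x
    rw [Pi.add_apply, ← integral_add (integrable_convolution σ q x) (integrable_convolution σ r x)]
    apply integral_congr_ae
    filter_upwards [Lp.coeFn_add q r] with y hy
    rw [hy, Pi.add_apply, mul_add]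
  map_smul' a q := by
    rw [RingHom.id_apply, ← MemLp.toLp_const_smul]
    congr 1
    ext1 x
    rw [Pi.smul_apply, smul_eq_mul, ← integral_const_mul]
    apply integral_congr_ae
    filter_upwards [Lp.coeFn_smul a q] with y hy
    rw [hy, Pi.smul_apply, smul_eq_mul, mul_left_comm]

theorem integral_mul_eq_inner {n : ℕ} (S φ : L2Space n) :
    ∫ z, S z * φ z = inner ℂ (star S) φ := by
  rw [L2.inner_def]
  apply integral_congr_ae
  filter_upwards [Lp.coeFn_star S] with z hz
  rw [hz, RCLike.inner_apply, Pi.star_apply, starRingEnd_apply, star_star, mul_comm]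

theorem norm_star_L2 {n : ℕ} (S : L2Space n) : ‖star S‖ = ‖S‖ := by
  rw [Lp.norm_def, Lp.norm_def]
  congr 1
  apply eLpNorm_congr_norm_ae
  filter_upwards [Lp.coeFn_star S] with z hz
  rw [hz, Pi.star_apply, norm_star]

/-- The linear form `φ ↦ ∫ S(z) φ(z) dz` on `L²(ℝ^n)`. -/
def pairing {n : ℕ} (S : L2Space n) : L2Space n →L[ℂ] ℂ :=
  LinearMap.mkContinuous
    { toFun := fun φ => ∫ z, S z * φ z
      map_add' := fun φ ψ => by
        simp only [integral_mul_eq_inner, inner_add_right]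
      map_smul' := fun a φ => by
        simp only [integral_mul_eq_inner, inner_smul_right, RingHom.id_apply, smul_eq_mul] }
    ‖S‖ fun φ => by
      change ‖∫ z, S z * φ z‖ ≤ _
      rw [integral_mul_eq_inner]
      exact (norm_inner_le_norm _ _).trans_eq (by rw [norm_star_L2])

/-- The map `φ ↦ (x ↦ ∫ S(z) φ(x, z) dz)` from `L²(𝕋^d; L²(ℝ^n))` to `L²(𝕋^d)`. -/
def fieldAverage {d n : ℕ} (S : L2Space n) : L2Field d n →L[ℂ] L2Torus d :=
  (pairing S).compLpL 2 volume

/-- The map `f ↦ ((x, z) ↦ f(x) S(z))` from `L²(𝕋^d)` to `L²(𝕋^d; L²(ℝ^n))`. -/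
def tensorField {d n : ℕ} (S : L2Space n) : L2Torus d →L[ℂ] L2Field d n :=
  (ContinuousLinearMap.toSpanSingleton ℂ S).compLpL 2 volume

/-- The Fourier transform of `(-Δ)^{-1/2} σ₂`. With the normalization
`𝓕 f(ξ) = ∫ f(z) exp (-2πi ξ · z) dz`, the operator `-Δ` has symbol `(2π|ξ|)²`. -/
def rieszSymbol {n : ℕ} (σ₂ : EuclideanSpace ℝ (Fin n) → ℝ) (ξ : EuclideanSpace ℝ (Fin n)) : ℂ :=
  𝓕 (fun z => (σ₂ z : ℂ)) ξ / ((2 * Real.pi * ‖ξ‖ : ℝ) : ℂ)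

/-- `(-Δ)^{-1/2} σ₂` as an element of `L²(ℝ^n)`. -/
def invSqrtLaplacian {n : ℕ} (σ₂ : EuclideanSpace ℝ (Fin n) → ℝ)
    (h : MemLp (rieszSymbol σ₂) 2 volume) : L2Space n :=
  𝓕⁻ (h.toLp (rieszSymbol σ₂))

/-- The constant `κ = ∫ σ₂ (-Δ)^{-1} σ₂ dz`, through Plancherel's formula. -/
def kappa {n : ℕ} (σ₂ : EuclideanSpace ℝ (Fin n) → ℝ) : ℝ :=
  ∫ ξ, ‖rieszSymbol σ₂ ξ‖ ^ 2

/-! ### The operator -/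

/-- The domain `H²(𝕋^d) × H²(𝕋^d) × L²(𝕋^d; L²(ℝ^n)) × L²(𝕋^d; L²(ℝ^n))`. -/
def domainL (d n : ℕ) : Submodule ℂ (StateSpace d n) where
  carrier := {X | X.fst.fst ∈ sobolevTwo d ∧ X.fst.snd ∈ sobolevTwo d}
  add_mem' hX hY := ⟨add_mem hX.1 hY.1, add_mem hX.2 hY.2⟩
  zero_mem' := ⟨zero_mem _, zero_mem _⟩
  smul_mem' a _ hX := ⟨Submodule.smul_mem _ a hX.1, Submodule.smul_mem _ a hX.2⟩

/-- The component `q` of an element of the domain. -/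
def compQ (d n : ℕ) : domainL d n →ₗ[ℂ] sobolevTwo d where
  toFun X := ⟨(X : StateSpace d n).fst.fst, X.2.1⟩
  map_add' _ _ := rfl
  map_smul' _ _ := rfl

/-- The component `p` of an element of the domain. -/
def compP (d n : ℕ) : domainL d n →ₗ[ℂ] sobolevTwo d where
  toFun X := ⟨(X : StateSpace d n).fst.snd, X.2.2⟩
  map_add' _ _ := rfl
  map_smul' _ _ := rfl

/-- The component `φ` of an element of the domain. -/
def compPhi (d n : ℕ) : domainL d n →ₗ[ℂ] L2Field d n where
  toFun X := (X : StateSpace d n).snd.fst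
  map_add' _ _ := rfl
  map_smul' _ _ := rfl

/-- The component `π` of an element of the domain. -/
def compPi (d n : ℕ) : domainL d n →ₗ[ℂ] L2Field d n where
  toFun X := (X : StateSpace d n).snd.snd
  map_add' _ _ := rfl
  map_smul' _ _ := rfl

/-- The unbounded operator
`(q, p, φ, π) ↦ (-½ Δq + k·∇p + γ σ₁ ⋆ ∫ S φ dz, -½ Δp - k·∇q, ½ φ + γ S (σ₁ ⋆ q), ½ π)`;
the operator of the theorem is obtained for `S = (-Δ)^{-1/2} σ₂`. -/
def operatorL {d n : ℕ} (k : Fin d → ℤ) (γ : ℝ) (σ₁ : C(Torus d, ℝ)) (S : L2Space n) :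
    StateSpace d n →ₗ.[ℂ] StateSpace d n where
  domain := domainL d n
  toFun :=
    { toFun := fun X =>
        let q := compQ d n X
        let p := compP d n X
        let φ := compPhi d n X
        let π := compPi d n X
        WithLp.toLp 2
          (WithLp.toLp 2
            (-((1 / 2 : ℂ) • laplacian d q) + dotGradient k p
                + (γ : ℂ) • convolution σ₁ (fieldAverage S φ),
              -((1 / 2 : ℂ) • laplacian d p) - dotGradient k q),
            WithLp.toLp 2
              ((1 / 2 : ℂ) • φ + (γ : ℂ) • tensorField S (convolution σ₁ (q : L2Torus d)),
                (1 / 2 : ℂ) • π))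
      map_add' := fun X Y => by
        simp only [Submodule.coe_add, map_add, smul_add, ← WithLp.toLp_add, Prod.mk_add_mk]
        congr 4 <;> abel
      map_smul' := fun a X => by
        simp only [Submodule.coe_smul, map_smul, smul_add, smul_neg, smul_sub, smul_comm a,
          RingHom.id_apply, ← WithLp.toLp_smul, Prod.smul_mk] }

/-- The vector `X₀ = (0, 𝟏, 0, 0)`. -/
def vectorXZero (d n : ℕ) : StateSpace d n :=
  WithLp.toLp 2 (WithLp.toLp 2 (0, characterL2 0), 0)

end SchrodingerWave

end

noncomputable section

namespace SchrodingerWave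

/-! ### Completeness of the characters -/

section Torus

variable {d : ℕ}

/-! The operator commutes with translations of the torus, so Fourier series split the equation `(L -
μ) X = Y` into independent problems indexed by `m`. For `μ ≠ 1/2` the field equations are algebraic:
`π` is a multiple of its datum and `φ` is an explicit function of `q` and its datum. Substituting
`φ` in the first equation leaves a 2 × 2 system for `(q_m, p_m)` with diagonal entries `B = m²/2 - μ
- T(m)/(1/2 - μ)` and `A = m²/2 - μ`, off-diagonal entries `± i k·m`, and determinant `D = A B -
(k·m)²`. Here `T(m) = γ² κ ((2π)^d σ_{1,m})²`: the factor `κ` is `∫ S²` because `S` is real, and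
`T(m) ≥ 0` because evenness makes `σ_{1,m}` real. The smallness condition says exactly what is
needed for `T(m) < 1/4`.

Since `|D|` grows like `m⁴`, locally uniformly in `μ ≠ 1/2`, only finitely many modes are singular
at a given `μ`, the zeros of `D` are isolated, and where no mode is singular the inverse matrices
are `O(1/(1 + m²))` and assemble into a resolvent with values in `H²`
(`mem_resolventSet_of_symD_ne_zero`). Where some are, the eigenspace is the finite sum of the
kernels of the singular matrices (`nonempty_eigenspace_equiv`). At `μ = 1/2` the component `π` is
free, which gives an infinite-dimensional eigenspace. Hence the essential spectrum.

For `μ < 0` one has `A > 0`, so zeros of `D` are zeros of the Schur complement `B - (k·m)²/A`, which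
decreases strictly in `μ` and is positive far to the left. A mode therefore carries one negative
eigenvalue if the Schur complement is negative at `0`, and none otherwise. For `m ≠ 0` its value at
`0` has the sign of `m⁴ - 4(k·m)² - 4 T(m) m²`. Integrality enters here: if `m⁴ - 4(k·m)²` is
positive it is at least `m²` (`le_sq_sub_four_mul_sq`), which exceeds `4 T(m) m²`. So the sign
depends only on the sign of `m⁴ - 4(k·m)²` and on whether `σ_{1,m}` vanishes. The mode `m = 0` has
value `-2 T(0) < 0` and gives the leading `1` of the index; at `μ = 0` it is also singular, with
kernel spanned by `X₀`. -/

theorem character_zero : character (0 : Fin d → ℤ) = 1 := by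
  ext x
  simp [character]

theorem character_add_index (m l : Fin d → ℤ) (x : Torus d) :
    character (m + l) x = character m x * character l x := by
  simp only [character, Pi.add_apply, fourier_add, ContinuousMap.coe_mk, ← Finset.prod_mul_distrib]

theorem character_neg_index (m : Fin d → ℤ) (x : Torus d) :
    character (-m) x = (starRingEnd ℂ) (character m x) := by
  simp only [character, Pi.neg_apply, fourier_neg, ContinuousMap.coe_mk, map_prod]

theorem character_add (m : Fin d → ℤ) (x y : Torus d) :
    character m (x + y) = character m x * character m y := by
  simp [character, ← Finset.prod_mul_distrib, AddCircle.toCircle_add, smul_add]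

theorem character_neg (m : Fin d → ℤ) (x : Torus d) :
    character m (-x) = character (-m) x := by
  simp only [character, ContinuousMap.coe_mk, Pi.neg_apply, fourier_apply, smul_neg, neg_smul]

theorem norm_character (m : Fin d → ℤ) (x : Torus d) : ‖character m x‖ = 1 := by
  simp only [character, ContinuousMap.coe_mk, norm_prod, fourier_apply, Circle.norm_coe,
    Finset.prod_const_one]

theorem character_single (x : Torus d) (i : Fin d) :
    character (Pi.single i 1) x = fourier 1 (x i) := by
  simp only [character, ContinuousMap.coe_mk]
  rw [Finset.prod_eq_single i]
  · simp
  · intro j _ hj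
    simp [Pi.single_eq_of_ne hj]
  · simp

/-- The star subalgebra of `C(𝕋^d, ℂ)` generated by the characters. -/
def characterSubalgebra (d : ℕ) : StarSubalgebra ℂ C(Torus d, ℂ) where
  toSubalgebra := Algebra.adjoin ℂ (Set.range character)
  star_mem' := by
    change Algebra.adjoin ℂ (Set.range character) ≤ star (Algebra.adjoin ℂ (Set.range character))
    refine Algebra.adjoin_le ?_
    rintro _ ⟨n, rfl⟩
    refine Algebra.subset_adjoin ⟨-n, ?_⟩
    ext1 x
    simp only [character_neg_index, starRingEnd_apply, ContinuousMap.star_apply]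

theorem characterSubalgebra_coe :
    (characterSubalgebra d).toSubalgebra.toSubmodule = Submodule.span ℂ (Set.range character) := by
  apply Algebra.adjoin_eq_span_of_subset
  refine .trans (fun x ↦ Submonoid.closure_induction (fun _ ↦ id) ⟨0, character_zero⟩ ?_)
    Submodule.subset_span
  rintro _ _ _ _ ⟨m, rfl⟩ ⟨n, rfl⟩
  exact ⟨m + n, ContinuousMap.ext fun x => character_add_index m n x⟩

/-- If two points differ in coordinate `i`, the character of the `i`-th unit vector tells them
apart, `toCircle` being injective on `ℝ / 2πℤ`. -/
theorem characterSubalgebra_separatesPoints : (characterSubalgebra d).SeparatesPoints := by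
  intro x y hxy
  obtain ⟨i, hi⟩ := Function.ne_iff.mp hxy
  refine ⟨_, ⟨character (Pi.single i 1), Algebra.subset_adjoin ⟨Pi.single i 1, rfl⟩, rfl⟩, ?_⟩
  change character (Pi.single i 1) x ≠ character (Pi.single i 1) y
  rw [character_single, character_single, fourier_one, fourier_one]
  exact fun h => hi (AddCircle.injective_toCircle Real.two_pi_pos.ne' (Circle.coe_injective h))

/-- Stone–Weierstrass: products and conjugates of characters are characters, so their span is
already a star subalgebra. -/
theorem span_character_closure_eq_top :
    (Submodule.span ℂ (Set.range (character (d := d)))).topologicalClosure = ⊤ := by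
  rw [← characterSubalgebra_coe]
  exact congr_arg (Subalgebra.toSubmodule <| StarSubalgebra.toSubalgebra ·)
    (ContinuousMap.starSubalgebra_topologicalClosure_eq_top_of_separatesPoints _
      characterSubalgebra_separatesPoints)

theorem span_characterL2_closure_eq_top :
    (Submodule.span ℂ (Set.range (characterL2 (d := d)))).topologicalClosure = ⊤ := by
  have h := (ContinuousMap.toLp_denseRange ℂ (volume : Measure (Torus d)) ℂ
    (p := 2) (by simp)).topologicalClosure_map_submodule span_character_closure_eq_top
  rw [Submodule.map_span, ← Set.range_comp] at h
  exact h

/-- The square root of the volume `(2π)^d` of the torus. -/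
def sqrtVolume (d : ℕ) : ℝ := Real.sqrt ((2 * Real.pi) ^ d)

theorem sqrtVolume_pos (d : ℕ) : 0 < sqrtVolume d := Real.sqrt_pos.mpr (by positivity)

theorem sqrtVolume_ne_zero (d : ℕ) : (sqrtVolume d : ℂ) ≠ 0 :=
  Complex.ofReal_ne_zero.mpr (sqrtVolume_pos d).ne'

theorem sqrtVolume_mul_self (d : ℕ) :
    (sqrtVolume d : ℂ) * sqrtVolume d = (2 * Real.pi : ℂ) ^ d := by
  rw [← Complex.ofReal_mul, sqrtVolume, Real.mul_self_sqrt (by positivity)]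
  push_cast
  rfl

theorem orthonormal_characterL2 :
    Orthonormal ℂ fun m : Fin d → ℤ => (sqrtVolume d : ℂ)⁻¹ • characterL2 m := by
  have h0 := sqrtVolume_ne_zero d
  rw [orthonormal_iff_ite]
  intro m l
  rw [inner_smul_left, inner_smul_right, inner_characterL2, map_inv₀, Complex.conj_ofReal]
  split_ifs
  · have := sqrtVolume_mul_self d
    push_cast
    rw [← this]
    field_simp
  · simp

/-- The normalized characters form a Hilbert basis of `L²(𝕋^d)`. -/
def characterBasis (d : ℕ) : HilbertBasis (Fin d → ℤ) ℂ (L2Torus d) :=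
  HilbertBasis.mk orthonormal_characterL2 (by
    rw [← span_characterL2_closure_eq_top]
    refine Submodule.topologicalClosure_mono (Submodule.span_le.mpr ?_)
    rintro _ ⟨m, rfl⟩
    have h : characterL2 m = (sqrtVolume d : ℂ) • ((sqrtVolume d : ℂ)⁻¹ • characterL2 m) := by
      rw [smul_smul, mul_inv_cancel₀ (sqrtVolume_ne_zero d), one_smul]
    rw [h]
    exact Submodule.smul_mem _ _ (Submodule.subset_span ⟨m, rfl⟩))

theorem characterBasis_apply (m : Fin d → ℤ) :
    characterBasis d m = (sqrtVolume d : ℂ)⁻¹ • characterL2 m := by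
  rw [characterBasis, HilbertBasis.coe_mk]

/-! ### Fourier coefficients as coordinates in the Hilbert basis -/

theorem inner_characterL2_left (m : Fin d → ℤ) (q : L2Torus d) :
    inner ℂ (characterL2 m) q = ∫ x, q x * character (-m) x := by
  rw [L2.inner_def]
  apply integral_congr_ae
  filter_upwards [ContinuousMap.coeFn_toLp (p := 2) (𝕜 := ℂ) volume (character m)] with x hx
  rw [characterL2, hx, character_neg_index, RCLike.inner_apply]

theorem coeff_eq_inner (q : L2Torus d) (m : Fin d → ℤ) :
    coeff q m = ((2 * Real.pi : ℂ) ^ d)⁻¹ * inner ℂ (characterL2 m) q := by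
  rw [inner_characterL2_left, coeff]

theorem coeff_eq_repr (q : L2Torus d) (m : Fin d → ℤ) :
    coeff q m = (sqrtVolume d : ℂ)⁻¹ * (characterBasis d).repr q m := by
  rw [HilbertBasis.repr_apply_apply, characterBasis_apply, inner_smul_left, map_inv₀,
    Complex.conj_ofReal, coeff_eq_inner, ← sqrtVolume_mul_self]
  ring

theorem repr_eq_coeff (q : L2Torus d) (m : Fin d → ℤ) :
    (characterBasis d).repr q m = (sqrtVolume d : ℂ) * coeff q m := by
  rw [coeff_eq_repr, mul_inv_cancel_left₀ (sqrtVolume_ne_zero d)]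

/-- A function of `L²(𝕋^d)` is determined by its Fourier coefficients. -/
theorem ext_coeff {q r : L2Torus d} (h : ∀ m, coeff q m = coeff r m) : q = r := by
  apply (characterBasis d).repr.injective
  ext m
  rw [repr_eq_coeff, repr_eq_coeff, h]

theorem coeff_zero (m : Fin d → ℤ) : coeff (0 : L2Torus d) m = 0 := by
  simpa using coeff_smul 0 (0 : L2Torus d) m

/-- The Fourier coefficient as a continuous linear form on `L²(𝕋^d)`. -/
def coeffL (m : Fin d → ℤ) : L2Torus d →L[ℂ] ℂ :=
  ((2 * Real.pi : ℂ) ^ d)⁻¹ • innerSL ℂ (characterL2 m)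

theorem coeffL_apply (m : Fin d → ℤ) (q : L2Torus d) : coeffL m q = coeff q m := by
  rw [coeff_eq_inner]
  rfl

theorem coeff_sub (q r : L2Torus d) (m : Fin d → ℤ) :
    coeff (q - r : L2Torus d) m = coeff q m - coeff r m := by
  simp only [← coeffL_apply, map_sub]

theorem coeff_neg (q : L2Torus d) (m : Fin d → ℤ) :
    coeff (-q : L2Torus d) m = - coeff q m := by
  simp only [← coeffL_apply, map_neg]

theorem coeff_sum {ι : Type*} (s : Finset ι) (f : ι → L2Torus d) (m : Fin d → ℤ) :
    coeff (∑ i ∈ s, f i : L2Torus d) m = ∑ i ∈ s, coeff (f i) m := by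
  simp only [← coeffL_apply, map_sum]

theorem coeff_characterL2 (m l : Fin d → ℤ) :
    coeff (characterL2 l) m = if m = l then 1 else 0 := by
  rw [coeff_eq_inner, inner_characterL2]
  split_ifs
  · push_cast
    exact inv_mul_cancel₀ (pow_ne_zero _ (by simp [Real.pi_ne_zero]))
  · simp

theorem summable_norm_coeff_sq (q : L2Torus d) : Summable fun m => ‖coeff q m‖ ^ 2 := by
  have h := (lp.memℓp ((characterBasis d).repr q)).summable (by norm_num)
  simp only [ENNReal.toReal_ofNat, Real.rpow_ofNat] at h
  refine (h.mul_left (‖(sqrtVolume d : ℂ)⁻¹‖ ^ 2)).congr fun m => ?_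
  rw [coeff_eq_repr, norm_mul, mul_pow]

/-! ### Fourier multipliers -/

theorem coeff_tsum {f : (Fin d → ℤ) → ℂ} (hf : Summable fun m => f m • characterL2 m)
    (m : Fin d → ℤ) : coeff (∑' l, f l • characterL2 l : L2Torus d) m = f m := by
  rw [← coeffL_apply, (coeffL m).map_tsum hf, tsum_eq_single m]
  · simp [coeffL_apply, coeff_characterL2]
  · intro l hl
    simp [coeffL_apply, coeff_characterL2, hl.symm]

theorem coeff_fourierMultiplier {a : (Fin d → ℤ) → ℂ}
    (ha : ∃ C : ℝ, ∀ m, ‖a m‖ ≤ C * (1 + ((m ⬝ᵥ m : ℤ) : ℝ))) (q : sobolevTwo d)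
    (m : Fin d → ℤ) :
    coeff (fourierMultiplier a ha q) m = a m * coeff (q : L2Torus d) m := by
  refine coeff_tsum (f := fun m => a m * coeff (q : L2Torus d) m)
    (summable_smul_characterL2 ?_) m
  obtain ⟨C, hC⟩ := ha
  refine Summable.of_nonneg_of_le (fun m => sq_nonneg _) (fun m => ?_) (q.2.mul_left (C ^ 2))
  rw [norm_mul, mul_pow, ← mul_assoc, ← mul_pow C]
  exact mul_le_mul_of_nonneg_right (pow_le_pow_left₀ (norm_nonneg _) (hC m) 2) (sq_nonneg _)

theorem coeff_laplacian (q : sobolevTwo d) (m : Fin d → ℤ) :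
    coeff (laplacian d q) m = -((m ⬝ᵥ m : ℤ) : ℂ) * coeff (q : L2Torus d) m :=
  coeff_fourierMultiplier _ q m

theorem coeff_dotGradient (k : Fin d → ℤ) (q : sobolevTwo d) (m : Fin d → ℤ) :
    coeff (dotGradient k q) m = Complex.I * ((k ⬝ᵥ m : ℤ) : ℂ) * coeff (q : L2Torus d) m :=
  coeff_fourierMultiplier _ q m

/-! ### Parseval's formula and bounded multipliers -/

theorem norm_sq_eq_tsum (q : L2Torus d) :
    ‖q‖ ^ 2 = sqrtVolume d ^ 2 * ∑' m, ‖coeff q m‖ ^ 2 := by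
  rw [← (characterBasis d).repr.norm_map q]
  have h := lp.norm_rpow_eq_tsum (p := 2) (by norm_num) ((characterBasis d).repr q)
  simp only [ENNReal.toReal_ofNat, Real.rpow_ofNat] at h
  rw [h, ← tsum_mul_left]
  congr 1
  ext m
  rw [repr_eq_coeff, norm_mul, mul_pow, Complex.norm_real, Real.norm_eq_abs, sq_abs]

theorem summable_boundedMultiplier {a : (Fin d → ℤ) → ℂ} {C : ℝ} (ha : ∀ m, ‖a m‖ ≤ C)
    (q : L2Torus d) : Summable fun m => ‖a m * coeff q m‖ ^ 2 := by
  refine Summable.of_nonneg_of_le (fun m => sq_nonneg _) (fun m => ?_)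
    ((summable_norm_coeff_sq q).mul_left (C ^ 2))
  rw [norm_mul, mul_pow]
  exact mul_le_mul_of_nonneg_right (pow_le_pow_left₀ (norm_nonneg _) (ha m) 2) (sq_nonneg _)

/-- A bounded symbol `a` defines a bounded Fourier multiplier on `L²(𝕋^d)`. -/
theorem exists_boundedMultiplier {a : (Fin d → ℤ) → ℂ} {C : ℝ} (ha : ∀ m, ‖a m‖ ≤ C) :
    ∃ T : L2Torus d →L[ℂ] L2Torus d, ∀ q m, coeff (T q) m = a m * coeff q m := by
  have hC : 0 ≤ C := (norm_nonneg _).trans (ha 0)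
  have hs := fun q : L2Torus d => summable_smul_characterL2 (summable_boundedMultiplier ha q)
  let T : L2Torus d →ₗ[ℂ] L2Torus d :=
    { toFun := fun q => ∑' m, (a m * coeff q m) • characterL2 m
      map_add' := fun q r => ext_coeff fun m => by
        rw [coeff_add, coeff_tsum (hs _), coeff_tsum (hs _), coeff_tsum (hs _), coeff_add]
        ring
      map_smul' := fun t q => ext_coeff fun m => by
        rw [RingHom.id_apply, coeff_smul, coeff_tsum (hs _), coeff_tsum (hs _), coeff_smul]
        ring }
  have hT : ∀ q m, coeff (T q) m = a m * coeff q m := fun q m => coeff_tsum (hs q) m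
  refine ⟨T.mkContinuous C fun q => ?_, hT⟩
  refine (sq_le_sq₀ (norm_nonneg _) (by positivity)).mp ?_
  rw [mul_pow, norm_sq_eq_tsum, norm_sq_eq_tsum q, mul_left_comm]
  refine mul_le_mul_of_nonneg_left ?_ (sq_nonneg _)
  rw [← tsum_mul_left]
  refine Summable.tsum_le_tsum (fun m => ?_) ?_ ((summable_norm_coeff_sq q).mul_left _)
  · rw [hT, norm_mul, mul_pow]
    exact mul_le_mul_of_nonneg_right (pow_le_pow_left₀ (norm_nonneg _) (ha m) 2) (sq_nonneg _)
  · exact summable_norm_coeff_sq _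

/-- If `(1 + m²) |q_m| ≤ C |r_m|` with `r ∈ L²(𝕋^d)`, then `q ∈ H²(𝕋^d)`. -/
theorem mem_sobolevTwo_of_norm_coeff_le {q r : L2Torus d} {C : ℝ}
    (h : ∀ m, (1 + ((m ⬝ᵥ m : ℤ) : ℝ)) * ‖coeff q m‖ ≤ C * ‖coeff r m‖) : q ∈ sobolevTwo d := by
  refine Summable.of_nonneg_of_le (fun m => by positivity) (fun m => ?_)
    ((summable_norm_coeff_sq r).mul_left (C ^ 2))
  have h1 := dotProduct_self_nonneg_real m
  rw [← mul_pow, ← mul_pow]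
  exact pow_le_pow_left₀ (by positivity) (h m) 2

theorem characterL2_mem_sobolevTwo (m : Fin d → ℤ) : characterL2 m ∈ sobolevTwo d := by
  refine mem_sobolevTwo_of_norm_coeff_le (r := characterL2 m) (C := 1 + ((m ⬝ᵥ m : ℤ) : ℝ))
    fun l => ?_
  rw [coeff_characterL2]
  split_ifs with h
  · rw [h]
  · simp

/-- Each ball of `ℤ^d` is finite. -/
theorem finite_dotProduct_self_le (C : ℝ) :
    {m : Fin d → ℤ | ((m ⬝ᵥ m : ℤ) : ℝ) ≤ C}.Finite := by
  refine (Set.finite_Icc (fun _ : Fin d => -⌈C⌉) (fun _ => ⌈C⌉)).subset fun m hm => ?_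
  have h1 : m ⬝ᵥ m ≤ ⌈C⌉ := by exact_mod_cast (hm : _ ≤ C).trans (Int.le_ceil C)
  have h2 : ∀ j, |m j| ≤ ⌈C⌉ := fun j => by
    have h3 : m j * m j ≤ m ⬝ᵥ m :=
      Finset.single_le_sum (N := ℤ) (s := Finset.univ) (f := fun j => m j * m j)
        (fun i _ => mul_self_nonneg (m i)) (Finset.mem_univ j)
    -- Integers satisfy `|t| ≤ t²`, so a bound on `m²` bounds every coordinate by the same constant.
    have h4 : |m j| ≤ |m j| * |m j| := by
      rcases eq_or_ne (m j) 0 with h | h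
      · simp [h]
      · exact le_mul_of_one_le_left (abs_nonneg _) (Int.one_le_abs h)
    rw [abs_mul_abs_self] at h4
    linarith
  exact ⟨fun j => (abs_le.mp (h2 j)).1, fun j => (abs_le.mp (h2 j)).2⟩

end Torus

/-! ### The convolution and the field operators -/

section Convolution

variable {d n : ℕ}

theorem two_pi_pow_ne_zero (d : ℕ) : (2 * Real.pi : ℂ) ^ d ≠ 0 :=
  pow_ne_zero _ (by simp [Real.pi_ne_zero])

theorem integral_mul_character (f : Torus d → ℂ) (m : Fin d → ℤ) :
    ∫ x, f x * character (-m) x = (2 * Real.pi : ℂ) ^ d * coeff f m := by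
  rw [coeff, mul_inv_cancel_left₀ (two_pi_pow_ne_zero d)]

/-- Fubini followed by the translation `x ↦ x + y`, under which the character factors. The power of
`2π` compensates for the normalization of `coeff`. -/
theorem coeff_convolution (σ : C(Torus d, ℝ)) (q : L2Torus d) (m : Fin d → ℤ) :
    coeff (convolution σ q) m
      = (2 * Real.pi : ℂ) ^ d * coeff (fun x => (σ x : ℂ)) m * coeff q m := by
  have h1 : ∫ x, (convolution σ q : L2Torus d) x * character (-m) x
      = ∫ x, ∫ y, (σ (x - y) : ℂ) * q y * character (-m) x := by
    apply integral_congr_ae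
    filter_upwards [MemLp.coeFn_toLp (((continuous_convolution σ q).memLp_of_hasCompactSupport
      (HasCompactSupport.of_compactSpace _) : MemLp _ 2 volume))] with x hx
    rw [integral_mul_const]
    exact congrArg (· * character (-m) x) hx
  have h2 : Integrable (Function.uncurry fun x y : Torus d =>
      (σ (x - y) : ℂ) * q y * character (-m) x) (volume.prod volume) := by
    have hq : Integrable (fun y => q y) volume := (Lp.memLp q).integrable one_le_two
    have h3 : Integrable (fun z : Torus d × Torus d => q z.2) (volume.prod volume) :=
      hq.comp_snd _
    have h4 : Continuous fun z : Torus d × Torus d =>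
        (σ (z.1 - z.2) : ℂ) * character (-m) z.1 := by fun_prop
    refine (h3.bdd_mul (c := ‖σ‖) h4.aestronglyMeasurable
      (Filter.Eventually.of_forall fun z => ?_)).congr
      (Filter.Eventually.of_forall fun z => ?_)
    · rw [norm_mul, norm_character, mul_one, Complex.norm_real]
      exact σ.norm_coe_le_norm _
    · simp only [Function.uncurry]
      ring
  have h5 : ∀ y : Torus d, ∫ x, (σ (x - y) : ℂ) * q y * character (-m) x
      = (∫ x, (σ x : ℂ) * character (-m) x) * (q y * character (-m) y) := by
    intro y
    rw [← integral_add_right_eq_self _ y, ← integral_mul_const]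
    congr 1
    ext x
    rw [add_sub_cancel_right, character_add]
    ring
  rw [coeff, h1, integral_integral_swap h2]
  simp_rw [h5]
  rw [integral_const_mul, integral_mul_character, mul_left_comm]
  rfl

theorem norm_two_pi_pow_mul_coeff_le (σ : C(Torus d, ℝ)) (m : Fin d → ℤ) :
    ‖(2 * Real.pi : ℂ) ^ d * coeff (fun x => (σ x : ℂ)) m‖ ≤ ∫ x, |σ x| := by
  rw [← integral_mul_character]
  refine (norm_integral_le_integral_norm _).trans_eq ?_
  congr 1
  ext x
  rw [norm_mul, norm_character, mul_one, Complex.norm_real, Real.norm_eq_abs]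

/-- Conjugation turns the character of `m` into that of `-m`, and the change of variable `x ↦ -x`
undoes this. Reality of the coefficients is what makes the squared coupling nonnegative. -/
theorem conj_coeff_of_even {σ : C(Torus d, ℝ)} (h : ∀ x, σ (-x) = σ x) (m : Fin d → ℤ) :
    (starRingEnd ℂ) (coeff (fun x => (σ x : ℂ)) m) = coeff (fun x => (σ x : ℂ)) m := by
  unfold coeff
  rw [map_mul, ← integral_conj]
  congr 1
  · simp [Complex.conj_ofNat]
  · have : (volume : Measure (Torus d)).IsNegInvariant :=
      Measure.IsAddHaarMeasure.isNegInvariant_of_regular _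
    rw [← integral_neg_eq_self]
    congr 1
    ext x
    rw [map_mul, Complex.conj_ofReal, h, ← character_neg_index, neg_neg, character_neg]

theorem coeff_ofReal_zero (σ : C(Torus d, ℝ)) :
    coeff (fun x => (σ x : ℂ)) 0 = ((2 * Real.pi : ℂ) ^ d)⁻¹ * ((∫ x, σ x : ℝ) : ℂ) := by
  rw [coeff, neg_zero, ← integral_complex_ofReal]
  simp [character_zero]

/-- Eliminating `φ` makes `q` act on itself through this composite, which reduces to a scalar. The
integrand carries no conjugate, so identifying the scalar with `κ` requires `S` to be real. -/
theorem fieldAverage_tensorField (S : L2Space n) (f : L2Torus d) :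
    fieldAverage S (tensorField S f) = (∫ z, S z * S z) • f := by
  apply Lp.ext
  filter_upwards [(pairing S).coeFn_compLpL (p := 2) (μ := volume) (tensorField S f),
    (ContinuousLinearMap.toSpanSingleton ℂ S).coeFn_compLpL (p := 2) (μ := volume) f,
    Lp.coeFn_smul (∫ z, S z * S z) f] with x h1 h2 h3
  rw [h3, fieldAverage, h1, tensorField, h2, ContinuousLinearMap.toSpanSingleton_apply, map_smul,
    Pi.smul_apply, smul_eq_mul, smul_eq_mul, mul_comm]
  rfl

/-- `L²(ℝ^n)` is infinite dimensional for `n ≥ 1`. -/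
theorem not_finiteDimensional_L2Space (hn : 0 < n) : ¬ FiniteDimensional ℂ (L2Space n) := by
  intro hfin
  let i₀ : Fin n := ⟨0, hn⟩
  -- Indicators of disjoint balls centred at the integer points of one axis form an infinite
  -- orthogonal family.
  let s : ℤ → Set (EuclideanSpace ℝ (Fin n)) := fun j =>
    Metric.ball (EuclideanSpace.single i₀ (j : ℝ)) (1 / 2)
  have hs : ∀ j, MeasurableSet (s j) := fun j => measurableSet_ball
  have hμ : ∀ j, volume (s j) ≠ ⊤ := fun j => measure_ball_lt_top.ne
  let f : ℤ → L2Space n := fun j => indicatorConstLp 2 (hs j) (hμ j) (1 : ℂ)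
  have hdisj : ∀ i j, i ≠ j → s i ∩ s j = ∅ := fun i j hij => by
    rw [← Set.disjoint_iff_inter_eq_empty]
    refine Metric.ball_disjoint_ball ?_
    rw [PiLp.dist_single_same, Real.dist_eq]
    have : (1 : ℝ) ≤ |(i : ℝ) - j| := by exact_mod_cast Int.one_le_abs (sub_ne_zero.mpr hij)
    linarith
  have hinner : ∀ i j, inner ℂ (f i) (f j) = (volume.real (s i ∩ s j) : ℂ) := fun i j =>
    L2.inner_indicatorConstLp_one_indicatorConstLp_one (hs i) (hs j) (hμ i) (hμ j)
  have hli : LinearIndependent ℂ f := by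
    refine linearIndependent_of_ne_zero_of_inner_eq_zero (𝕜 := ℂ) (fun j h0 => ?_)
      (fun i j hij => ?_)
    · have h1 := hinner j j
      rw [h0, inner_zero_left, Set.inter_self] at h1
      have h2 : 0 < volume.real (s j) :=
        ENNReal.toReal_pos (Metric.measure_ball_pos volume _ (by norm_num)).ne' (hμ j)
      exact h2.ne (by exact_mod_cast h1)
    · change inner ℂ (f i) (f j) = 0
      rw [hinner, hdisj i j hij]
      simp
  have := hli.finite
  exact not_finite ℤ

theorem not_finiteDimensional_L2Field (hn : 0 < n) : ¬ FiniteDimensional ℂ (L2Field d n) := by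
  intro hfin
  apply not_finiteDimensional_L2Space hn
  have : NeZero (volume : Measure (Torus d)) := ⟨fun h =>
    (isOpen_univ.measure_pos (volume : Measure (Torus d)) Set.univ_nonempty).ne' (by rw [h]; rfl)⟩
  -- The constant functions embed `L²(ℝ^n)` into the fields, since the torus has positive finite
  -- mass.
  refine FiniteDimensional.of_injective (Lp.constₗ 2 (volume : Measure (Torus d)) ℂ
    (E := L2Space n)) ((injective_iff_map_eq_zero _).mpr fun g hg => ?_)
  have h := Lp.norm_const (p := 2) (μ := (volume : Measure (Torus d))) (c := g) (by norm_num)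
  rw [Lp.constₗ_apply] at hg
  rw [hg, norm_zero] at h
  have h2 : (0 : ℝ) < (volume : Measure (Torus d)).real Set.univ := measureReal_univ_pos
  have h3 := (mul_eq_zero.mp h.symm).resolve_right (Real.rpow_pos_of_pos h2 _).ne'
  exact norm_eq_zero.mp h3

end Convolution

/-! ### Reality of `(-Δ)^{-1/2} σ₂` and its norm -/

section Riesz

variable {n : ℕ}

/-- The reflection `f ↦ conj (f (-·))` on `L²(ℝ^n)`. -/
def reflectL2 (f : L2Space n) : L2Space n :=
  star (Lp.compMeasurePreserving (fun z : EuclideanSpace ℝ (Fin n) => -z)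
    (Measure.measurePreserving_neg volume) f)

theorem coeFn_reflectL2 (f : L2Space n) :
    reflectL2 f =ᵐ[volume] fun z => (starRingEnd ℂ) (f (-z)) := by
  filter_upwards [Lp.coeFn_star (Lp.compMeasurePreserving
      (fun z : EuclideanSpace ℝ (Fin n) => -z) (Measure.measurePreserving_neg volume) f),
    Lp.coeFn_compMeasurePreserving f (Measure.measurePreserving_neg volume)] with z h1 h2
  rw [reflectL2, h1, Pi.star_apply, h2]
  rfl

theorem isometry_star_L2 : Isometry (star : L2Space n → L2Space n) := by
  refine Isometry.of_dist_eq fun f g => ?_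
  rw [dist_eq_norm, dist_eq_norm, ← norm_star_L2 (f - g)]
  congr 1
  apply Lp.ext
  filter_upwards [Lp.coeFn_sub (star f) (star g), Lp.coeFn_star f, Lp.coeFn_star g,
    Lp.coeFn_star (f - g), Lp.coeFn_sub f g] with z h1 h2 h3 h4 h5
  rw [h1, Pi.sub_apply, h2, h3, h4, Pi.star_apply, Pi.star_apply, Pi.star_apply, h5,
    Pi.sub_apply, star_sub]

theorem continuous_reflectL2 : Continuous (reflectL2 : L2Space n → L2Space n) :=
  isometry_star_L2.continuous.comp
    (Lp.isometry_compMeasurePreserving (Measure.measurePreserving_neg volume)).continuous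

/-- The reflection `f ↦ conj (f (-·))` on Schwartz functions. -/
def reflectSchwartz (g : SchwartzMap (EuclideanSpace ℝ (Fin n)) ℂ) :
    SchwartzMap (EuclideanSpace ℝ (Fin n)) ℂ :=
  (SchwartzMap.compCLMOfContinuousLinearEquiv ℝ
    (ContinuousLinearEquiv.neg ℝ (M := EuclideanSpace ℝ (Fin n))) g).postcompCLM
      (Complex.conjCLE : ℂ →L[ℝ] ℂ)

theorem reflectSchwartz_apply (g : SchwartzMap (EuclideanSpace ℝ (Fin n)) ℂ)
    (z : EuclideanSpace ℝ (Fin n)) : reflectSchwartz g z = (starRingEnd ℂ) (g (-z)) := rfl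

theorem reflectL2_toLp (g : SchwartzMap (EuclideanSpace ℝ (Fin n)) ℂ) :
    reflectL2 (g.toLp 2) = (reflectSchwartz g).toLp 2 := by
  apply Lp.ext
  filter_upwards [coeFn_reflectL2 (g.toLp 2), (reflectSchwartz g).coeFn_toLp 2 volume,
    (Measure.measurePreserving_neg
      (volume : Measure (EuclideanSpace ℝ (Fin n)))).quasiMeasurePreserving.ae
      (g.coeFn_toLp 2 volume)] with z h1 h2 h3
  rw [h1, h2, reflectSchwartz_apply, h3]

theorem conj_fourierInv (g : EuclideanSpace ℝ (Fin n) → ℂ) (w : EuclideanSpace ℝ (Fin n)) :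
    (starRingEnd ℂ) (𝓕⁻ g w) = 𝓕⁻ (fun z => (starRingEnd ℂ) (g (-z))) w := by
  rw [Real.fourierInv_eq', Real.fourierInv_eq', ← integral_conj, ← integral_neg_eq_self]
  congr 1
  ext v
  simp only [smul_eq_mul, map_mul, ← Complex.exp_conj, Complex.conj_ofReal, Complex.conj_I,
    inner_neg_left]
  congr 2
  push_cast
  ring

/-- On Schwartz functions this is a change of variable in the integral; both sides are continuous on
`L²`, so density concludes. -/
theorem star_fourierInv (f : L2Space n) : star (𝓕⁻ f) = 𝓕⁻ (reflectL2 f) := by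
  refine DenseRange.induction_on
    (SchwartzMap.denseRange_toLpCLM (E := EuclideanSpace ℝ (Fin n)) (F := ℂ) (p := 2)
      (μ := volume) ENNReal.ofNat_ne_top) f ?_ ?_
  · have h : Continuous fun f : L2Space n => 𝓕⁻ f :=
      (Lp.fourierTransformₗᵢ (EuclideanSpace ℝ (Fin n)) ℂ).symm.continuous
    exact isClosed_eq (isometry_star_L2.continuous.comp h) (h.comp continuous_reflectL2)
  · intro g
    rw [SchwartzMap.toLpCLM_apply, reflectL2_toLp, SchwartzMap.toLp_fourierInv_eq,
      SchwartzMap.toLp_fourierInv_eq]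
    apply Lp.ext
    filter_upwards [Lp.coeFn_star ((𝓕⁻ g).toLp 2), (𝓕⁻ g).coeFn_toLp 2 volume,
      (𝓕⁻ (reflectSchwartz g)).coeFn_toLp 2 volume] with z h1 h2 h3
    rw [h1, Pi.star_apply, h2, h3, SchwartzMap.fourierInv_coe, SchwartzMap.fourierInv_coe]
    exact conj_fourierInv _ _

/-- The Fourier transform of a real function is Hermitian and `|ξ|` is even. Through
`star_fourierInv` this makes `(-Δ)^{-1/2} σ₂` real. -/
theorem conj_rieszSymbol_neg (σ₂ : EuclideanSpace ℝ (Fin n) → ℝ)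
    (ξ : EuclideanSpace ℝ (Fin n)) :
    (starRingEnd ℂ) (rieszSymbol σ₂ (-ξ)) = rieszSymbol σ₂ ξ := by
  unfold rieszSymbol
  rw [map_div₀, Complex.conj_ofReal, norm_neg, Real.fourier_eq', Real.fourier_eq', ← integral_conj]
  congr 2
  ext v
  simp only [smul_eq_mul, map_mul, ← Complex.exp_conj, Complex.conj_ofReal, Complex.conj_I,
    inner_neg_right]
  congr 2
  push_cast
  ring

theorem star_invSqrtLaplacian (σ₂ : EuclideanSpace ℝ (Fin n) → ℝ)
    (h : MemLp (rieszSymbol σ₂) 2 volume) :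
    star (invSqrtLaplacian σ₂ h) = invSqrtLaplacian σ₂ h := by
  rw [invSqrtLaplacian, star_fourierInv]
  congr 1
  apply Lp.ext
  filter_upwards [coeFn_reflectL2 (h.toLp (rieszSymbol σ₂)), h.coeFn_toLp,
    (Measure.measurePreserving_neg
      (volume : Measure (EuclideanSpace ℝ (Fin n)))).quasiMeasurePreserving.ae
      h.coeFn_toLp] with z h1 h2 h3
  rw [h1, h2, h3, conj_rieszSymbol_neg]

theorem norm_invSqrtLaplacian_sq (σ₂ : EuclideanSpace ℝ (Fin n) → ℝ)
    (h : MemLp (rieszSymbol σ₂) 2 volume) : ‖invSqrtLaplacian σ₂ h‖ ^ 2 = kappa σ₂ := by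
  have h1 : ‖invSqrtLaplacian σ₂ h‖ = ‖h.toLp (rieszSymbol σ₂)‖ :=
    (Lp.fourierTransformₗᵢ (EuclideanSpace ℝ (Fin n)) ℂ).symm.norm_map _
  rw [h1, ← @inner_self_eq_norm_sq ℂ, L2.inner_def, kappa, ← integral_re (L2.integrable_inner _ _)]
  apply integral_congr_ae
  filter_upwards [h.coeFn_toLp] with z hz
  rw [inner_self_eq_norm_sq, hz]

/-- `∫ S² = κ` for `S = (-Δ)^{-1/2} σ₂`. -/
theorem integral_invSqrtLaplacian_mul_self (σ₂ : EuclideanSpace ℝ (Fin n) → ℝ)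
    (h : MemLp (rieszSymbol σ₂) 2 volume) :
    ∫ z, invSqrtLaplacian σ₂ h z * invSqrtLaplacian σ₂ h z = (kappa σ₂ : ℂ) := by
  rw [integral_mul_eq_inner, star_invSqrtLaplacian, inner_self_eq_norm_sq_to_K,
    ← norm_invSqrtLaplacian_sq σ₂ h]
  push_cast
  rfl

/-- The quotient is `0` at the origin by the convention on division, but nonzero on the complement,
a nonempty open set. Positivity is needed for `T m = 0` to detect exactly the vanishing of
`σ_{1,m}`. -/
theorem kappa_pos (hn : 0 < n) {σ₂ : EuclideanSpace ℝ (Fin n) → ℝ}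
    (h : MemLp (rieszSymbol σ₂) 2 volume) (h0 : ∀ ξ, 𝓕 (fun z => (σ₂ z : ℂ)) ξ ≠ 0) :
    0 < kappa σ₂ := by
  have : Nontrivial (EuclideanSpace ℝ (Fin n)) := by
    have : Nonempty (Fin n) := ⟨⟨0, hn⟩⟩
    infer_instance
  have hint : Integrable (fun ξ => ‖rieszSymbol σ₂ ξ‖ ^ 2) volume :=
    (memLp_two_iff_integrable_sq_norm h.1).mp h
  rw [kappa, integral_pos_iff_support_of_nonneg (fun ξ => sq_nonneg _) hint]
  refine (isOpen_compl_singleton.measure_pos volume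
    (exists_ne (0 : EuclideanSpace ℝ (Fin n)))).trans_le (measure_mono fun ξ hξ => ?_)
  have hξ' : ‖ξ‖ ≠ 0 := norm_ne_zero_iff.mpr hξ
  rw [Function.mem_support, rieszSymbol]
  refine pow_ne_zero _ (norm_ne_zero_iff.mpr (div_ne_zero (h0 ξ) ?_))
  exact Complex.ofReal_ne_zero.mpr (mul_ne_zero (by positivity) hξ')

end Riesz

/-! ### The reduced symbol -/

section Symbol

variable {d : ℕ}

/-- The entry `m²/2 - μ` of the reduced symbol. -/
def symA (m : Fin d → ℤ) (μ : ℂ) : ℂ := ((m ⬝ᵥ m : ℤ) : ℂ) / 2 - μ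

/-- The entry `m²/2 - μ - T(m)/(1/2 - μ)` of the reduced symbol. -/
def symB (T : (Fin d → ℤ) → ℝ) (m : Fin d → ℤ) (μ : ℂ) : ℂ := symA m μ - T m / (1 / 2 - μ)

/-- The determinant of the reduced symbol, obtained by eliminating the fields. -/
def symD (k : Fin d → ℤ) (T : (Fin d → ℤ) → ℝ) (m : Fin d → ℤ) (μ : ℂ) : ℂ :=
  symA m μ * symB T m μ - ((k ⬝ᵥ m : ℤ) : ℂ) ^ 2

/-- The kernel of the reduced symbol. -/
def symKer (k : Fin d → ℤ) (T : (Fin d → ℤ) → ℝ) (m : Fin d → ℤ) (μ : ℂ) :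
    Submodule ℂ (ℂ × ℂ) where
  carrier := {v | symB T m μ * v.1 + Complex.I * ((k ⬝ᵥ m : ℤ) : ℂ) * v.2 = 0 ∧
    symA m μ * v.2 - Complex.I * ((k ⬝ᵥ m : ℤ) : ℂ) * v.1 = 0}
  add_mem' {v w} hv hw := ⟨by
    have := congrArg₂ (· + ·) hv.1 hw.1
    simp only [Prod.fst_add, Prod.snd_add] at this ⊢
    linear_combination this, by
    have := congrArg₂ (· + ·) hv.2 hw.2
    simp only [Prod.fst_add, Prod.snd_add] at this ⊢
    linear_combination this⟩
  zero_mem' := by simp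
  smul_mem' t v hv := ⟨by
    simp only [Prod.smul_fst, Prod.smul_snd, smul_eq_mul]
    linear_combination t * hv.1, by
    simp only [Prod.smul_fst, Prod.smul_snd, smul_eq_mul]
    linear_combination t * hv.2⟩

theorem mem_symKer {k : Fin d → ℤ} {T : (Fin d → ℤ) → ℝ} {m : Fin d → ℤ} {μ : ℂ} {v : ℂ × ℂ} :
    v ∈ symKer k T m μ ↔ symB T m μ * v.1 + Complex.I * ((k ⬝ᵥ m : ℤ) : ℂ) * v.2 = 0 ∧
      symA m μ * v.2 - Complex.I * ((k ⬝ᵥ m : ℤ) : ℂ) * v.1 = 0 := Iff.rfl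

/-- Multiplication by the adjugate matrix, as in Cramer's rule. -/
theorem eq_zero_of_mem_symKer {k : Fin d → ℤ} {T : (Fin d → ℤ) → ℝ} {m : Fin d → ℤ} {μ : ℂ}
    (hD : symD k T m μ ≠ 0) {v : ℂ × ℂ} (hv : v ∈ symKer k T m μ) : v = 0 := by
  obtain ⟨h1, h2⟩ := hv
  have e1 : symD k T m μ * v.1 = 0 := by
    rw [symD]
    linear_combination symA m μ * h1 - Complex.I * ((k ⬝ᵥ m : ℤ) : ℂ) * h2
      - ((k ⬝ᵥ m : ℤ) : ℂ) ^ 2 * v.1 * Complex.I_sq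
  have e2 : symD k T m μ * v.2 = 0 := by
    rw [symD]
    linear_combination symB T m μ * h2 + Complex.I * ((k ⬝ᵥ m : ℤ) : ℂ) * h1
      - ((k ⬝ᵥ m : ℤ) : ℂ) ^ 2 * v.2 * Complex.I_sq
  exact Prod.ext ((mul_eq_zero.mp e1).resolve_left hD) ((mul_eq_zero.mp e2).resolve_left hD)

theorem symKer_eq_span_of_symA {k : Fin d → ℤ} {T : (Fin d → ℤ) → ℝ} {m : Fin d → ℤ} {μ : ℂ}
    (hD : symD k T m μ = 0) (hA : symA m μ ≠ 0) :
    symKer k T m μ = Submodule.span ℂ {(symA m μ, Complex.I * ((k ⬝ᵥ m : ℤ) : ℂ))} := by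
  rw [symD] at hD
  apply le_antisymm
  · rintro v ⟨-, h2⟩
    rw [Submodule.mem_span_singleton]
    refine ⟨v.1 / symA m μ, Prod.ext ?_ ?_⟩
    · simp only [Prod.smul_mk, smul_eq_mul]
      field_simp
    · simp only [Prod.smul_mk, smul_eq_mul]
      field_simp
      linear_combination -h2
  · rw [Submodule.span_singleton_le_iff_mem]
    refine ⟨?_, ?_⟩
    · linear_combination hD + ((k ⬝ᵥ m : ℤ) : ℂ) ^ 2 * Complex.I_sq
    · ring

theorem symKer_eq_span_of_symB {k : Fin d → ℤ} {T : (Fin d → ℤ) → ℝ} {m : Fin d → ℤ} {μ : ℂ}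
    (hD : symD k T m μ = 0) (hB : symB T m μ ≠ 0) :
    symKer k T m μ = Submodule.span ℂ {(-(Complex.I * ((k ⬝ᵥ m : ℤ) : ℂ)), symB T m μ)} := by
  rw [symD] at hD
  apply le_antisymm
  · rintro v ⟨h1, -⟩
    rw [Submodule.mem_span_singleton]
    refine ⟨v.2 / symB T m μ, Prod.ext ?_ ?_⟩
    · simp only [Prod.smul_mk, smul_eq_mul]
      field_simp
      linear_combination -h1
    · simp only [Prod.smul_mk, smul_eq_mul]
      field_simp
  · rw [Submodule.span_singleton_le_iff_mem]
    refine ⟨?_, ?_⟩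
    · ring
    · linear_combination hD + ((k ⬝ᵥ m : ℤ) : ℂ) ^ 2 * Complex.I_sq

/-- A singular nonzero 2 × 2 matrix has a line as kernel. When the determinant vanishes, a zero
diagonal forces `k·m = 0`, so the hypothesis excludes only the zero matrix. -/
theorem finrank_symKer {k : Fin d → ℤ} {T : (Fin d → ℤ) → ℝ} {m : Fin d → ℤ} {μ : ℂ}
    (hD : symD k T m μ = 0) (h : symA m μ ≠ 0 ∨ symB T m μ ≠ 0) :
    Module.finrank ℂ (symKer k T m μ) = 1 := by
  rcases h with h | h
  · rw [symKer_eq_span_of_symA hD h]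
    exact finrank_span_singleton fun h0 => h (congrArg Prod.fst h0)
  · rw [symKer_eq_span_of_symB hD h]
    exact finrank_span_singleton fun h0 => h (congrArg Prod.snd h0)

theorem symKer_ne_bot {k : Fin d → ℤ} {T : (Fin d → ℤ) → ℝ} {m : Fin d → ℤ} {μ : ℂ}
    (hD : symD k T m μ = 0) : symKer k T m μ ≠ ⊥ := by
  intro hbot
  by_cases h : symA m μ ≠ 0 ∨ symB T m μ ≠ 0
  · have h1 := finrank_symKer hD h
    rw [hbot, finrank_bot] at h1
    exact zero_ne_one h1
  · push Not at h
    have hb : ((k ⬝ᵥ m : ℤ) : ℂ) = 0 := by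
      rw [symD, h.1, zero_mul, zero_sub, neg_eq_zero] at hD
      exact pow_eq_zero_iff two_ne_zero |>.mp hD
    have h1 : ((1 : ℂ), (0 : ℂ)) ∈ symKer k T m μ := by
      rw [mem_symKer, h.1, h.2, hb]
      simp
    rw [hbot, Submodule.mem_bot] at h1
    exact one_ne_zero (congrArg Prod.fst h1)

/-! ### Growth of the reduced symbol -/

theorem dotProduct_sq_le (k m : Fin d → ℤ) :
    ((k ⬝ᵥ m : ℤ) : ℝ) ^ 2 ≤ ((k ⬝ᵥ k : ℤ) : ℝ) * ((m ⬝ᵥ m : ℤ) : ℝ) := by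
  have h := Finset.sum_mul_sq_le_sq_mul_sq Finset.univ k m
  simp only [pow_two, dotProduct] at h ⊢
  exact_mod_cast h

theorem norm_dotProduct_self_half (m : Fin d → ℤ) :
    ‖((m ⬝ᵥ m : ℤ) : ℂ) / 2‖ = ((m ⬝ᵥ m : ℤ) : ℝ) / 2 := by
  rw [norm_div, Complex.norm_intCast, abs_of_nonneg (dotProduct_self_nonneg_real m)]
  norm_num

variable {T : (Fin d → ℤ) → ℝ}

theorem norm_symB_sub_le (hT0 : ∀ m, 0 ≤ T m) (hT1 : ∀ m, T m < 1 / 4) {M : ℝ} {μ : ℂ}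
    (hinv : ‖(1 / 2 - μ)⁻¹‖ ≤ M) (m : Fin d → ℤ) : ‖(T m : ℂ) / (1 / 2 - μ)‖ ≤ M := by
  rw [div_eq_mul_inv, norm_mul, Complex.norm_real, Real.norm_of_nonneg (hT0 m)]
  have := norm_nonneg (1 / 2 - μ)⁻¹
  nlinarith [hT0 m, hT1 m]

/-- The product of the diagonal entries is of order `m⁴`, while `(k·m)² ≤ k² m²`. The bound `R`
depends on `μ` only through `M`; this uniformity is used to isolate the zeros. -/
theorem exists_le_norm_symD (k : Fin d → ℤ) (hT0 : ∀ m, 0 ≤ T m) (hT1 : ∀ m, T m < 1 / 4) (M : ℝ) :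
    ∃ R : ℝ, ∀ (μ : ℂ), ‖μ‖ ≤ M → ‖(1 / 2 - μ)⁻¹‖ ≤ M → ∀ m : Fin d → ℤ,
      R ≤ ((m ⬝ᵥ m : ℤ) : ℝ) → (1 + ((m ⬝ᵥ m : ℤ) : ℝ)) ^ 2 ≤ 64 * ‖symD k T m μ‖ := by
  -- With `a = m²`, the term `8|M|` gives `|A| ≥ 3a/8` and `|B| ≥ a/4`; the term `64 k²` gives
  -- `(k·m)² ≤ a²/64`. Hence `64|D| ≥ 5a²`, and `a ≥ 1` gives `(1 + a)² ≤ 4a²`.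
  refine ⟨1 + 8 * |M| + 64 * ((k ⬝ᵥ k : ℤ) : ℝ), fun μ hμ hinv m hm => ?_⟩
  set a : ℝ := ((m ⬝ᵥ m : ℤ) : ℝ) with ha
  have hk := dotProduct_self_nonneg_real k
  have hM := (norm_nonneg _).trans hμ
  rw [abs_of_nonneg hM] at hm
  have hA : 3 * a / 8 ≤ ‖symA m μ‖ := by
    have h := norm_sub_norm_le (((m ⬝ᵥ m : ℤ) : ℂ) / 2) μ
    rw [norm_dotProduct_self_half] at h
    rw [symA]
    linarith
  have hB : a / 4 ≤ ‖symB T m μ‖ := by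
    have h1 := norm_sub_norm_le (symA m μ) ((T m : ℂ) / (1 / 2 - μ))
    have h2 := norm_symB_sub_le hT0 hT1 hinv m
    rw [symB]
    linarith
  have hD : ‖symA m μ‖ * ‖symB T m μ‖ - ((k ⬝ᵥ m : ℤ) : ℝ) ^ 2 ≤ ‖symD k T m μ‖ := by
    have h := norm_sub_norm_le (symA m μ * symB T m μ) (((k ⬝ᵥ m : ℤ) : ℂ) ^ 2)
    rwa [norm_mul, norm_pow, Complex.norm_intCast, sq_abs] at h
  have hAB : 3 * a / 8 * (a / 4) ≤ ‖symA m μ‖ * ‖symB T m μ‖ :=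
    mul_le_mul hA hB (by linarith) (norm_nonneg _)
  have hb := dotProduct_sq_le k m
  have h1 : 64 * ((k ⬝ᵥ k : ℤ) : ℝ) * a ≤ a * a := mul_le_mul_of_nonneg_right (by linarith)
    (by linarith)
  nlinarith

theorem exists_norm_bound {μ : ℂ} : ∃ M : ℝ, ‖μ‖ ≤ M ∧ ‖(1 / 2 - μ)⁻¹‖ ≤ M :=
  ⟨max ‖μ‖ ‖(1 / 2 - μ)⁻¹‖, le_max_left _ _, le_max_right _ _⟩

theorem finite_symD_eq_zero (k : Fin d → ℤ) (hT0 : ∀ m, 0 ≤ T m) (hT1 : ∀ m, T m < 1 / 4) (μ : ℂ) :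
    {m | symD k T m μ = 0}.Finite := by
  obtain ⟨M, hM1, hM2⟩ := exists_norm_bound (μ := μ)
  obtain ⟨R, hR⟩ := exists_le_norm_symD k hT0 hT1 M
  refine (finite_dotProduct_self_le R).subset fun m hm => ?_
  by_contra h
  have h1 := hR μ hM1 hM2 m (not_le.mp h).le
  rw [hm, norm_zero, mul_zero] at h1
  have := dotProduct_self_nonneg_real m
  nlinarith

theorem exists_le_mul_norm_symD (k : Fin d → ℤ) (hT0 : ∀ m, 0 ≤ T m) (hT1 : ∀ m, T m < 1 / 4)
    {μ : ℂ} (hD : ∀ m, symD k T m μ ≠ 0) :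
    ∃ C : ℝ, 0 ≤ C ∧ ∀ m, (1 + ((m ⬝ᵥ m : ℤ) : ℝ)) ^ 2 ≤ C * ‖symD k T m μ‖ := by
  obtain ⟨M, hM1, hM2⟩ := exists_norm_bound (μ := μ)
  obtain ⟨R, hR⟩ := exists_le_norm_symD k hT0 hT1 M
  obtain ⟨C, hC⟩ := ((finite_dotProduct_self_le (d := d) R).image fun m =>
    (1 + ((m ⬝ᵥ m : ℤ) : ℝ)) ^ 2 / ‖symD k T m μ‖).bddAbove
  refine ⟨max C 64, le_max_of_le_right (by norm_num), fun m => ?_⟩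
  have hpos := norm_pos_iff.mpr (hD m)
  rcases le_total ((m ⬝ᵥ m : ℤ) : ℝ) R with h | h
  · have h1 := hC (Set.mem_image_of_mem _ h)
    rw [div_le_iff₀ hpos] at h1
    exact h1.trans (mul_le_mul_of_nonneg_right (le_max_left _ _) hpos.le)
  · exact (hR μ hM1 hM2 m h).trans (mul_le_mul_of_nonneg_right (le_max_right _ _) hpos.le)

/-- The entries of the inverse of the reduced symbol are `O(1 / (1 + m²))`. -/
theorem exists_norm_div_symD_le (k : Fin d → ℤ) (hT0 : ∀ m, 0 ≤ T m) (hT1 : ∀ m, T m < 1 / 4)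
    {μ : ℂ} (hD : ∀ m, symD k T m μ ≠ 0) :
    ∃ C : ℝ, ∀ m, (1 + ((m ⬝ᵥ m : ℤ) : ℝ)) * ‖symA m μ / symD k T m μ‖ ≤ C ∧
      (1 + ((m ⬝ᵥ m : ℤ) : ℝ)) * ‖symB T m μ / symD k T m μ‖ ≤ C ∧
      (1 + ((m ⬝ᵥ m : ℤ) : ℝ)) * ‖Complex.I * ((k ⬝ᵥ m : ℤ) : ℂ) / symD k T m μ‖ ≤ C := by
  obtain ⟨C, hC0, hC⟩ := exists_le_mul_norm_symD k hT0 hT1 hD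
  obtain ⟨M, hM1, hM2⟩ := exists_norm_bound (μ := μ)
  have hM := (norm_nonneg _).trans hM1
  have hk := dotProduct_self_nonneg_real k
  set K : ℝ := 1 + 2 * M + ((k ⬝ᵥ k : ℤ) : ℝ) with hK
  have key : ∀ (m : Fin d → ℤ) (x : ℂ), ‖x‖ ≤ K * (1 + ((m ⬝ᵥ m : ℤ) : ℝ)) →
      (1 + ((m ⬝ᵥ m : ℤ) : ℝ)) * ‖x / symD k T m μ‖ ≤ C * K := by
    intro m x hx
    have hpos := norm_pos_iff.mpr (hD m)
    have hm := dotProduct_self_nonneg_real m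
    rw [norm_div, mul_div_assoc', div_le_iff₀ hpos]
    calc (1 + ((m ⬝ᵥ m : ℤ) : ℝ)) * ‖x‖
        ≤ (1 + ((m ⬝ᵥ m : ℤ) : ℝ)) * (K * (1 + ((m ⬝ᵥ m : ℤ) : ℝ))) := by gcongr
      _ = K * (1 + ((m ⬝ᵥ m : ℤ) : ℝ)) ^ 2 := by ring
      _ ≤ K * (C * ‖symD k T m μ‖) := by gcongr; exact hC m
      _ = _ := by ring
  refine ⟨C * K, fun m => ?_⟩
  have hm := dotProduct_self_nonneg_real m
  have hA : ‖symA m μ‖ ≤ ((m ⬝ᵥ m : ℤ) : ℝ) / 2 + M := by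
    rw [symA, ← norm_dotProduct_self_half]
    exact (norm_sub_le _ _).trans (by linarith)
  refine ⟨key m _ ?_, key m _ ?_, key m _ ?_⟩
  · refine hA.trans ?_
    rw [hK]
    nlinarith [mul_nonneg hk hm, mul_nonneg hM hm]
  · have h1 : ‖symB T m μ‖ ≤ ((m ⬝ᵥ m : ℤ) : ℝ) / 2 + M + M := by
      rw [symB]
      exact (norm_sub_le _ _).trans (add_le_add hA (norm_symB_sub_le hT0 hT1 hM2 m))
    refine h1.trans ?_
    rw [hK]
    nlinarith [mul_nonneg hk hm, mul_nonneg hM hm]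
  · rw [norm_mul, Complex.norm_I, one_mul, Complex.norm_intCast]
    have hb := dotProduct_sq_le k m
    rw [hK]
    refine abs_le_of_sq_le_sq (hb.trans ?_) (by positivity)
    nlinarith [mul_nonneg hk hm, mul_nonneg hM hm, mul_nonneg (mul_nonneg hk hm) hM,
      mul_nonneg (mul_nonneg hk hm) hk, mul_nonneg (mul_nonneg hk hm) hm,
      mul_nonneg (mul_nonneg hk hm) (mul_nonneg hk hm), sq_nonneg (1 + 2 * M)]

/-! ### Isolation of the zeros -/

/-- Multiplication by `1/2 - μ` clears the denominator and leaves a cubic polynomial in `μ`. -/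
theorem finite_zeros_symD (k : Fin d → ℤ) (T : (Fin d → ℤ) → ℝ) (m : Fin d → ℤ) :
    {μ : ℂ | μ ≠ 1 / 2 ∧ symD k T m μ = 0}.Finite := by
  open Polynomial in
  let P : ℂ[X] := (C (1 / 2) - X) * (C (((m ⬝ᵥ m : ℤ) : ℂ) / 2) - X) ^ 2
    - C (T m : ℂ) * (C (((m ⬝ᵥ m : ℤ) : ℂ) / 2) - X)
    - C (((k ⬝ᵥ m : ℤ) : ℂ) ^ 2) * (C (1 / 2) - X)
  have heval : ∀ μ : ℂ, P.eval μ = (1 / 2 - μ) * symA m μ ^ 2 - T m * symA m μ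
      - ((k ⬝ᵥ m : ℤ) : ℂ) ^ 2 * (1 / 2 - μ) := by
    intro μ
    simp only [P, Polynomial.eval_sub, Polynomial.eval_mul, Polynomial.eval_pow,
      Polynomial.eval_C, Polynomial.eval_X, symA]
  have hP : P ≠ 0 := by
    intro h0
    have h1 : ∀ μ : ℂ, (1 / 2 - μ) * symA m μ ^ 2 - T m * symA m μ
        - ((k ⬝ᵥ m : ℤ) : ℂ) ^ 2 * (1 / 2 - μ) = 0 := fun μ => by
      rw [← heval, h0, Polynomial.eval_zero]
    -- The third finite difference over `0, 1, 2, 3` sees only the leading term `-μ³`.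
    have h2 : (6 : ℂ) = 0 := by
      have e0 := h1 0
      have e1 := h1 1
      have e2 := h1 2
      have e3 := h1 3
      simp only [symA] at e0 e1 e2 e3
      linear_combination e0 - 3 * e1 + 3 * e2 - e3
    norm_num at h2
  refine (P.roots.toFinset.finite_toSet).subset fun μ hμ => ?_
  obtain ⟨h1, h2⟩ := hμ
  have h3 : (1 / 2 - μ) ≠ 0 := sub_ne_zero.mpr (Ne.symm h1)
  rw [Finset.mem_coe, Multiset.mem_toFinset, Polynomial.mem_roots hP, Polynomial.IsRoot, heval]
  have h4 : (1 / 2 - μ) * symD k T m μ = 0 := by rw [h2, mul_zero]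
  have h5 : (1 / 2 - μ) * (T m / (1 / 2 - μ)) = T m := mul_div_cancel₀ _ h3
  rw [symD, symB] at h4
  linear_combination h4 + symA m μ * h5

theorem isolated_zeros_symD (k : Fin d → ℤ) (hT0 : ∀ m, 0 ≤ T m) (hT1 : ∀ m, T m < 1 / 4)
    {μ : ℂ} (hμ : μ ≠ 1 / 2) :
    ∃ ε > 0, ∀ ν : ℂ, ‖ν - μ‖ < ε → ν ≠ 1 / 2 ∧ ((∃ m, symD k T m ν = 0) → ν = μ) := by
  set r : ℝ := ‖1 / 2 - μ‖ / 2 with hr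
  have hr0 : 0 < r := half_pos (norm_pos_iff.mpr (sub_ne_zero.mpr hμ.symm))
  -- This constant bounds both `|ν|` and `|1/2 - ν|⁻¹` on the ball of radius `r` about `μ`. There
  -- only the finitely many modes with `m² ≤ R` can be singular, each at finitely many points.
  obtain ⟨R, hR⟩ := exists_le_norm_symD k hT0 hT1 (‖μ‖ + r + r⁻¹)
  set Z : Set ℂ := ⋃ m ∈ {m : Fin d → ℤ | ((m ⬝ᵥ m : ℤ) : ℝ) ≤ R},
    {ν : ℂ | ν ≠ 1 / 2 ∧ symD k T m ν = 0} with hZ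
  have hZfin : (Z \ {μ}).Finite :=
    ((finite_dotProduct_self_le R).biUnion fun m _ => finite_zeros_symD k T m).subset
      Set.sdiff_subset
  obtain ⟨δ, hδ, hball⟩ := Metric.isOpen_iff.mp hZfin.isClosed.isOpen_compl μ (by simp)
  refine ⟨min δ r, lt_min hδ hr0, fun ν hν => ?_⟩
  have hνr : ‖ν - μ‖ < r := hν.trans_le (min_le_right _ _)
  have hlow : r < ‖1 / 2 - ν‖ := by
    have h := norm_sub_norm_le (1 / 2 - μ) (ν - μ)
    have h2 : (1 / 2 - μ) - (ν - μ) = 1 / 2 - ν := by ring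
    rw [h2] at h
    linarith
  have hν2 : ν ≠ 1 / 2 := by
    rintro rfl
    rw [sub_self, norm_zero] at hlow
    linarith
  refine ⟨hν2, ?_⟩
  rintro ⟨m, hm⟩
  by_contra hne
  have hmR : ((m ⬝ᵥ m : ℤ) : ℝ) ≤ R := by
    by_contra h
    have h1 : ‖ν‖ ≤ ‖μ‖ + r + r⁻¹ := by
      have h2 := norm_sub_norm_le ν μ
      have h3 := inv_pos.mpr hr0
      linarith
    have h4 : ‖(1 / 2 - ν)⁻¹‖ ≤ ‖μ‖ + r + r⁻¹ := by
      rw [norm_inv]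
      have h2 : ‖1 / 2 - ν‖⁻¹ ≤ r⁻¹ := inv_anti₀ hr0 hlow.le
      have h3 := norm_nonneg μ
      linarith
    have h5 := hR ν h1 h4 m (not_le.mp h).le
    rw [hm, norm_zero, mul_zero] at h5
    have := dotProduct_self_nonneg_real m
    nlinarith
  refine hball (a := ν) ?_ ⟨Set.mem_biUnion hmR ⟨hν2, hm⟩, hne⟩
  rw [Metric.mem_ball, dist_eq_norm]
  exact hν.trans_le (min_le_left _ _)

end Symbol

/-! ### Zeros on the negative half line -/

section Scalar

/-- The Schur complement of the reduced symbol for real `μ ≤ 0`. -/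
def schurComplement (a b t μ : ℝ) : ℝ := a / 2 - μ - t / (1 / 2 - μ) - b ^ 2 / (a / 2 - μ)

/-- The term `-μ` decreases strictly, and both subtracted fractions grow as their denominators
shrink. -/
theorem schurComplement_strictAnti {a b t μ ν : ℝ} (ha : 0 ≤ a) (ht : 0 ≤ t)
    (hab : a = 0 → b = 0) (hμν : μ < ν) (hν : ν ≤ 0) :
    schurComplement a b t ν < schurComplement a b t μ := by
  have h1 : t / (1 / 2 - μ) ≤ t / (1 / 2 - ν) :=
    div_le_div_of_nonneg_left ht (by linarith) (by linarith)
  have h2 : b ^ 2 / (a / 2 - μ) ≤ b ^ 2 / (a / 2 - ν) := by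
    -- For `a = 0` the denominator may vanish at `ν = 0`; then `b = 0` and the fraction is `0`
    -- throughout, `0 / 0` included.
    rcases ha.eq_or_lt with h | h
    · simp [hab h.symm]
    · exact div_le_div_of_nonneg_left (sq_nonneg b) (by linarith) (by linarith)
  unfold schurComplement
  linarith

theorem continuousOn_schurComplement {a b t : ℝ} (ha : 0 ≤ a) (hab : a = 0 → b = 0) :
    ContinuousOn (schurComplement a b t) (Set.Iic 0) := by
  unfold schurComplement
  refine ContinuousOn.sub (ContinuousOn.sub (by fun_prop) ?_) ?_
  · refine ContinuousOn.div (by fun_prop) (by fun_prop) fun x hx => ?_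
    have : x ≤ 0 := hx
    linarith
  · rcases ha.eq_or_lt with h | h
    · simp [hab h.symm, continuousOn_const]
    · refine ContinuousOn.div (by fun_prop) (by fun_prop) fun x hx => ?_
      have : x ≤ 0 := hx
      linarith

theorem exists_schurComplement_eq_zero {a b t : ℝ} (ha : 0 ≤ a) (ht : 0 ≤ t)
    (hab : a = 0 → b = 0) (h0 : schurComplement a b t 0 < 0) :
    ∃ μ < 0, schurComplement a b t μ = 0 := by
  -- At `-x` the two fractions are at most `2t` and `|b|`, so the value is at least `x - 2t - |b| =
  -- 1`.
  set x : ℝ := 2 * t + |b| + 1 with hx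
  have hx0 : 0 < x := by positivity
  have hpos : 0 < schurComplement a b t (-x) := by
    unfold schurComplement
    have h1 : t / (1 / 2 - -x) ≤ 2 * t := by
      rw [div_le_iff₀ (by linarith)]
      nlinarith
    have h2 : b ^ 2 / (a / 2 - -x) ≤ |b| := by
      rw [div_le_iff₀ (by linarith), ← sq_abs]
      nlinarith [abs_nonneg b]
    linarith
  obtain ⟨μ, hμ, h⟩ := intermediate_value_Icc' (neg_nonpos.mpr hx0.le)
    ((continuousOn_schurComplement (t := t) ha hab).mono fun y hy => hy.2) ⟨h0.le, hpos.le⟩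
  refine ⟨μ, lt_of_le_of_ne hμ.2 ?_, h⟩
  rintro rfl
  exact h0.ne h

/-- For integers `a ≥ 1` and `b` with `a² > 4b²` one has `a² - 4b² ≥ a`. -/
theorem le_sq_sub_four_mul_sq {a b : ℤ} (ha : 1 ≤ a) (h : 0 < a ^ 2 - 4 * b ^ 2) :
    a ≤ a ^ 2 - 4 * b ^ 2 := by
  -- In `(a - 2|b|)(a + 2|b|)` the first factor is then a positive integer, and the second is at
  -- least `a`.
  have h1 : 2 * |b| < a := by
    refine lt_of_pow_lt_pow_left₀ 2 (by linarith) ?_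
    rw [mul_pow, sq_abs]
    linarith
  rw [← sq_abs b]
  nlinarith [abs_nonneg b]

end Scalar

/-! ### Eigenspaces and spectrum -/

section Abstract

variable {V : Type*} [NormedAddCommGroup V] [NormedSpace ℂ V]

theorem mem_eigenspace {A : V →ₗ.[ℂ] V} {μ : ℂ} {x : V} :
    x ∈ eigenspace A μ ↔ ∃ h : x ∈ A.domain, A ⟨x, h⟩ - μ • x = 0 := by
  constructor
  · rintro ⟨y, hy, rfl⟩
    exact ⟨y.2, hy⟩
  · rintro ⟨h, hx⟩
    exact ⟨⟨x, h⟩, hx, rfl⟩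

theorem mem_unboundedSpectrum_of_eigenspace_ne_bot {A : V →ₗ.[ℂ] V} {μ : ℂ}
    (h : eigenspace A μ ≠ ⊥) : μ ∈ unboundedSpectrum A := by
  rintro ⟨R, -, hR⟩
  refine h ((Submodule.eq_bot_iff _).mpr fun x hx => ?_)
  obtain ⟨hd, hx⟩ := mem_eigenspace.mp hx
  have := hR ⟨x, hd⟩
  rw [hx, map_zero] at this
  exact this.symm

end Abstract

/-! ### The eigenvalue equation -/

section Operator

variable {d n : ℕ}

/-- The element of the state space of components `q`, `p`, `φ`, `π`. -/
def mkState (q p : L2Torus d) (φ π : L2Field d n) : StateSpace d n :=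
  WithLp.toLp 2 (WithLp.toLp 2 (q, p), WithLp.toLp 2 (φ, π))

theorem stateSpace_ext {X Y : StateSpace d n} (h1 : X.fst.fst = Y.fst.fst)
    (h2 : X.fst.snd = Y.fst.snd) (h3 : X.snd.fst = Y.snd.fst) (h4 : X.snd.snd = Y.snd.snd) :
    X = Y := by
  apply WithLp.ofLp_injective
  refine Prod.ext ?_ ?_
  · exact WithLp.ofLp_injective _ (Prod.ext h1 h2)
  · exact WithLp.ofLp_injective _ (Prod.ext h3 h4)

variable (k : Fin d → ℤ) (γ : ℝ) (σ : C(Torus d, ℝ)) (S : L2Space n)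

theorem operatorL_sub_smul_eq_iff (μ : ℂ) (X : domainL d n) (Y : StateSpace d n) :
    operatorL k γ σ S X - μ • (X : StateSpace d n) = Y ↔
      (-((1 / 2 : ℂ) • laplacian d (compQ d n X)) + dotGradient k (compP d n X)
        + (γ : ℂ) • convolution σ (fieldAverage S X.1.snd.fst) - μ • X.1.fst.fst = Y.fst.fst) ∧
      (-((1 / 2 : ℂ) • laplacian d (compP d n X)) - dotGradient k (compQ d n X)
        - μ • X.1.fst.snd = Y.fst.snd) ∧
      ((1 / 2 : ℂ) • X.1.snd.fst + (γ : ℂ) • tensorField S (convolution σ X.1.fst.fst)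
        - μ • X.1.snd.fst = Y.snd.fst) ∧
      ((1 / 2 : ℂ) • X.1.snd.snd - μ • X.1.snd.snd = Y.snd.snd) := by
  constructor
  · rintro rfl
    exact ⟨rfl, rfl, rfl, rfl⟩
  · rintro ⟨h1, h2, h3, h4⟩
    exact stateSpace_ext h1 h2 h3 h4

variable {k γ σ S} {κ : ℝ} {T : (Fin d → ℤ) → ℝ}

/-- Elimination of the fields from the equation `(L - μ) X = Y`, for `μ ≠ 1/2`. -/
theorem operatorL_sub_smul_eq_iff_coeff (hS : ∫ z, S z * S z = (κ : ℂ))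
    (hT : ∀ m, ((γ : ℂ) * ((2 * Real.pi : ℂ) ^ d * coeff (fun x => (σ x : ℂ)) m)) ^ 2 * κ = T m)
    {μ : ℂ} (hμ : μ ≠ 1 / 2) (X : domainL d n) (Y : StateSpace d n) :
    operatorL k γ σ S X - μ • (X : StateSpace d n) = Y ↔
      (∀ m, symB T m μ * coeff X.1.fst.fst m
          + Complex.I * ((k ⬝ᵥ m : ℤ) : ℂ) * coeff X.1.fst.snd m
          = coeff (Y.fst.fst - ((γ : ℂ) * (1 / 2 - μ)⁻¹) •
              convolution σ (fieldAverage S Y.snd.fst) : L2Torus d) m ∧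
        symA m μ * coeff X.1.fst.snd m - Complex.I * ((k ⬝ᵥ m : ℤ) : ℂ) * coeff X.1.fst.fst m
          = coeff Y.fst.snd m) ∧
      X.1.snd.fst = (1 / 2 - μ)⁻¹ •
        (Y.snd.fst - (γ : ℂ) • tensorField S (convolution σ X.1.fst.fst)) ∧
      X.1.snd.snd = (1 / 2 - μ)⁻¹ • Y.snd.snd := by
  have hμ' : (1 / 2 - μ) ≠ 0 := sub_ne_zero.mpr hμ.symm
  rw [operatorL_sub_smul_eq_iff]
  have e4 : (1 / 2 : ℂ) • X.1.snd.snd - μ • X.1.snd.snd = Y.snd.snd ↔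
      X.1.snd.snd = (1 / 2 - μ)⁻¹ • Y.snd.snd := by
    rw [← sub_smul, eq_inv_smul_iff₀ hμ']
  have e3 : (1 / 2 : ℂ) • X.1.snd.fst + (γ : ℂ) • tensorField S (convolution σ X.1.fst.fst)
        - μ • X.1.snd.fst = Y.snd.fst ↔ X.1.snd.fst = (1 / 2 - μ)⁻¹ •
        (Y.snd.fst - (γ : ℂ) • tensorField S (convolution σ X.1.fst.fst)) := by
    rw [eq_inv_smul_iff₀ hμ', eq_sub_iff_add_eq, sub_smul, add_sub_right_comm]
  have e2 : -((1 / 2 : ℂ) • laplacian d (compP d n X)) - dotGradient k (compQ d n X)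
        - μ • X.1.fst.snd = Y.fst.snd ↔ ∀ m, symA m μ * coeff X.1.fst.snd m
          - Complex.I * ((k ⬝ᵥ m : ℤ) : ℂ) * coeff X.1.fst.fst m = coeff Y.fst.snd m := by
    have key : ∀ m, coeff (-((1 / 2 : ℂ) • laplacian d (compP d n X))
        - dotGradient k (compQ d n X) - μ • X.1.fst.snd : L2Torus d) m
        = symA m μ * coeff X.1.fst.snd m
          - Complex.I * ((k ⬝ᵥ m : ℤ) : ℂ) * coeff X.1.fst.fst m := fun m => by
      rw [coeff_sub, coeff_sub, coeff_neg, coeff_smul, coeff_smul, coeff_laplacian,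
        coeff_dotGradient, symA]
      change -(1 / 2 * (-((m ⬝ᵥ m : ℤ) : ℂ) * coeff X.1.fst.snd m))
        - Complex.I * ((k ⬝ᵥ m : ℤ) : ℂ) * coeff X.1.fst.fst m - μ * coeff X.1.fst.snd m = _
      ring
    exact ⟨fun h m => by rw [← key, h], fun h => ext_coeff fun m => by rw [key, h]⟩
  -- The equation for `q` decouples over modes only after `φ` is replaced by its value, so this
  -- equivalence is conditional on the field equation.
  have e1 : X.1.snd.fst = (1 / 2 - μ)⁻¹ •
        (Y.snd.fst - (γ : ℂ) • tensorField S (convolution σ X.1.fst.fst)) →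
      (-((1 / 2 : ℂ) • laplacian d (compQ d n X)) + dotGradient k (compP d n X)
        + (γ : ℂ) • convolution σ (fieldAverage S X.1.snd.fst) - μ • X.1.fst.fst = Y.fst.fst ↔
      ∀ m, symB T m μ * coeff X.1.fst.fst m
          + Complex.I * ((k ⬝ᵥ m : ℤ) : ℂ) * coeff X.1.fst.snd m
          = coeff (Y.fst.fst - ((γ : ℂ) * (1 / 2 - μ)⁻¹) •
              convolution σ (fieldAverage S Y.snd.fst) : L2Torus d) m) := by
    intro hφ
    have havg : fieldAverage S X.1.snd.fst = (1 / 2 - μ)⁻¹ • (fieldAverage S Y.snd.fst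
        - (γ : ℂ) • (κ : ℂ) • convolution σ X.1.fst.fst) := by
      rw [hφ, map_smul, map_sub, map_smul, fieldAverage_tensorField, hS]
    have key : ∀ m, coeff (-((1 / 2 : ℂ) • laplacian d (compQ d n X))
        + dotGradient k (compP d n X)
        + (γ : ℂ) • convolution σ (fieldAverage S X.1.snd.fst) - μ • X.1.fst.fst : L2Torus d) m
        = symB T m μ * coeff X.1.fst.fst m
          + Complex.I * ((k ⬝ᵥ m : ℤ) : ℂ) * coeff X.1.fst.snd m
          + (γ : ℂ) * (1 / 2 - μ)⁻¹ *
            coeff (convolution σ (fieldAverage S Y.snd.fst) : L2Torus d) m := fun m => by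
      rw [havg, coeff_sub, coeff_add, coeff_add, coeff_neg, coeff_smul, coeff_smul, coeff_smul,
        coeff_laplacian, coeff_dotGradient, coeff_convolution, coeff_smul, coeff_sub, coeff_smul,
        coeff_smul, coeff_convolution, coeff_convolution, symB, symA, ← hT]
      change -(1 / 2 * (-((m ⬝ᵥ m : ℤ) : ℂ) * coeff X.1.fst.fst m))
        + Complex.I * ((k ⬝ᵥ m : ℤ) : ℂ) * coeff X.1.fst.snd m + _ - μ * coeff X.1.fst.fst m = _
      rw [div_eq_mul_inv (_ * (κ : ℂ))]
      ring
    constructor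
    · intro h m
      rw [coeff_sub, coeff_smul, ← h, key]
      ring
    · intro h
      refine ext_coeff fun m => ?_
      rw [key, h, coeff_sub, coeff_smul]
      ring
  rw [e2, e3, e4]
  constructor
  · rintro ⟨h1, h2, h3, h4⟩
    exact ⟨fun m => ⟨(e1 h3).mp h1 m, h2 m⟩, h3, h4⟩
  · rintro ⟨h12, h3, h4⟩
    exact ⟨(e1 h3).mpr fun m => (h12 m).1, fun m => (h12 m).2, h3, h4⟩

/-! ### Eigenspaces -/

theorem mem_eigenspace_operatorL (hS : ∫ z, S z * S z = (κ : ℂ))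
    (hT : ∀ m, ((γ : ℂ) * ((2 * Real.pi : ℂ) ^ d * coeff (fun x => (σ x : ℂ)) m)) ^ 2 * κ = T m)
    {μ : ℂ} (hμ : μ ≠ 1 / 2) {X : StateSpace d n} :
    X ∈ eigenspace (operatorL k γ σ S) μ ↔ X ∈ domainL d n ∧
      (∀ m, (coeff X.fst.fst m, coeff X.fst.snd m) ∈ symKer k T m μ) ∧
      X.snd.fst = (1 / 2 - μ)⁻¹ • -((γ : ℂ) • tensorField S (convolution σ X.fst.fst)) ∧
      X.snd.snd = 0 := by
  rw [mem_eigenspace]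
  have key : ∀ h : X ∈ domainL d n, operatorL k γ σ S ⟨X, h⟩ - μ • X = 0 ↔
      (∀ m, (coeff X.fst.fst m, coeff X.fst.snd m) ∈ symKer k T m μ) ∧
      X.snd.fst = (1 / 2 - μ)⁻¹ • -((γ : ℂ) • tensorField S (convolution σ X.fst.fst)) ∧
      X.snd.snd = 0 := by
    intro h
    have h1 := operatorL_sub_smul_eq_iff_coeff (k := k) hS hT hμ ⟨X, h⟩ 0
    have h2 : ∀ m, coeff ((0 : StateSpace d n).fst.fst - ((γ : ℂ) * (1 / 2 - μ)⁻¹) •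
        convolution σ (fieldAverage S (0 : StateSpace d n).snd.fst) : L2Torus d) m = 0 := by
      intro m
      change coeff ((0 : L2Torus d) - ((γ : ℂ) * (1 / 2 - μ)⁻¹) •
        convolution σ (fieldAverage S (0 : L2Field d n)) : L2Torus d) m = 0
      rw [map_zero, map_zero, smul_zero, sub_zero, coeff_zero]
    have h3 : ∀ m, coeff (0 : StateSpace d n).fst.snd m = 0 := coeff_zero
    simp only [h2, h3] at h1
    refine h1.trans (and_congr Iff.rfl (and_congr ?_ ?_))
    · rw [show (0 : StateSpace d n).snd.fst = 0 from rfl, zero_sub]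
    · rw [show (0 : StateSpace d n).snd.snd = 0 from rfl, smul_zero]
  exact ⟨fun ⟨h, hX⟩ => ⟨h, (key h).mp hX⟩, fun ⟨h, hX⟩ => ⟨h, (key h).mpr hX⟩⟩

/-- For `μ ≠ 1/2` the eigenspace of `μ` is the direct sum of the kernels of the reduced symbol. -/
theorem nonempty_eigenspace_equiv (hS : ∫ z, S z * S z = (κ : ℂ))
    (hT : ∀ m, ((γ : ℂ) * ((2 * Real.pi : ℂ) ^ d * coeff (fun x => (σ x : ℂ)) m)) ^ 2 * κ = T m)
    (hT0 : ∀ m, 0 ≤ T m) (hT1 : ∀ m, T m < 1 / 4) {μ : ℂ} (hμ : μ ≠ 1 / 2) :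
    Nonempty (eigenspace (operatorL k γ σ S) μ ≃ₗ[ℂ]
      ((m : {m | symD k T m μ = 0}) → symKer k T m.1 μ)) := by
  have hmem := fun X : StateSpace d n => mem_eigenspace_operatorL (k := k) (X := X) hS hT hμ
  have : Fintype {m | symD k T m μ = 0} := (finite_symD_eq_zero k hT0 hT1 μ).fintype
  let Φ : eigenspace (operatorL k γ σ S) μ →ₗ[ℂ]
      ((m : {m | symD k T m μ = 0}) → symKer k T m.1 μ) :=
    { toFun := fun X m => ⟨(coeff X.1.fst.fst m.1, coeff X.1.fst.snd m.1),
        ((hmem X).mp X.2).2.1 m.1⟩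
      map_add' := fun X Y => funext fun m => Subtype.ext
        (Prod.ext (coeff_add _ _ _) (coeff_add _ _ _))
      map_smul' := fun t X => funext fun m => Subtype.ext
        (Prod.ext (coeff_smul _ _ _) (coeff_smul _ _ _)) }
  refine ⟨LinearEquiv.ofBijective Φ ⟨?_, ?_⟩⟩
  · rw [← LinearMap.ker_eq_bot, LinearMap.ker_eq_bot']
    intro X hX
    obtain ⟨-, h1, h2, h3⟩ := (hmem X).mp X.2
    have h4 : ∀ m, (coeff X.1.fst.fst m, coeff X.1.fst.snd m) = 0 := by
      intro m
      by_cases hm : symD k T m μ = 0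
      · exact congrArg Subtype.val (congrFun hX ⟨m, hm⟩)
      · exact eq_zero_of_mem_symKer hm (h1 m)
    have h5 : X.1.fst.fst = 0 := ext_coeff fun m => by
      rw [coeff_zero]
      exact congrArg Prod.fst (h4 m)
    have h6 : X.1.fst.snd = 0 := ext_coeff fun m => by
      rw [coeff_zero]
      exact congrArg Prod.snd (h4 m)
    refine Subtype.ext (stateSpace_ext h5 h6 ?_ h3)
    rw [h2, h5, map_zero, map_zero, smul_zero, neg_zero, smul_zero]
    rfl
  · intro f
    -- Only finitely many modes are singular, so the preimage is a trigonometric polynomial and lies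
    -- in `H²` automatically.
    let q : L2Torus d := ∑ m, (f m).1.1 • characterL2 m.1
    let p : L2Torus d := ∑ m, (f m).1.2 • characterL2 m.1
    have hcoeff : ∀ (g : {m | symD k T m μ = 0} → ℂ) (l : Fin d → ℤ),
        coeff (∑ m, g m • characterL2 m.1 : L2Torus d) l
          = if h : symD k T l μ = 0 then g ⟨l, h⟩ else 0 := by
      intro g l
      simp only [coeff_sum, coeff_smul, coeff_characterL2, mul_ite, mul_one, mul_zero]
      split_ifs with h
      · rw [Finset.sum_eq_single ⟨l, h⟩]
        · simp
        · intro m _ hm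
          rw [if_neg fun h1 => hm (Subtype.ext h1.symm)]
        · simp
      · refine Finset.sum_eq_zero fun m _ => if_neg fun h1 => h ?_
        rw [h1]
        exact m.2
    have hq : q ∈ sobolevTwo d := Submodule.sum_mem _ fun m _ =>
      Submodule.smul_mem _ _ (characterL2_mem_sobolevTwo _)
    have hp : p ∈ sobolevTwo d := Submodule.sum_mem _ fun m _ =>
      Submodule.smul_mem _ _ (characterL2_mem_sobolevTwo _)
    let X : StateSpace d n := mkState q p
      ((1 / 2 - μ)⁻¹ • -((γ : ℂ) • tensorField S (convolution σ q))) 0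
    have hX : X ∈ eigenspace (operatorL k γ σ S) μ := by
      refine (hmem X).mpr ⟨⟨hq, hp⟩, fun m => ?_, rfl, rfl⟩
      change (coeff q m, coeff p m) ∈ _
      rw [hcoeff, hcoeff]
      split_ifs with h
      · exact (f ⟨m, h⟩).2
      · exact zero_mem _
    refine ⟨⟨X, hX⟩, funext fun m => Subtype.ext (Prod.ext ?_ ?_)⟩
    · exact (hcoeff _ m.1).trans (dif_pos m.2)
    · exact (hcoeff _ m.1).trans (dif_pos m.2)

theorem finiteDimensional_eigenspace (hS : ∫ z, S z * S z = (κ : ℂ))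
    (hT : ∀ m, ((γ : ℂ) * ((2 * Real.pi : ℂ) ^ d * coeff (fun x => (σ x : ℂ)) m)) ^ 2 * κ = T m)
    (hT0 : ∀ m, 0 ≤ T m) (hT1 : ∀ m, T m < 1 / 4) {μ : ℂ} (hμ : μ ≠ 1 / 2) :
    FiniteDimensional ℂ (eigenspace (operatorL k γ σ S) μ) := by
  have : Fintype {m | symD k T m μ = 0} := (finite_symD_eq_zero k hT0 hT1 μ).fintype
  obtain ⟨e⟩ := nonempty_eigenspace_equiv (k := k) hS hT hT0 hT1 hμ
  exact e.symm.finiteDimensional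

theorem eigenspace_ne_bot_of_symD_eq_zero (hS : ∫ z, S z * S z = (κ : ℂ))
    (hT : ∀ m, ((γ : ℂ) * ((2 * Real.pi : ℂ) ^ d * coeff (fun x => (σ x : ℂ)) m)) ^ 2 * κ = T m)
    (hT0 : ∀ m, 0 ≤ T m) (hT1 : ∀ m, T m < 1 / 4) {μ : ℂ} (hμ : μ ≠ 1 / 2) {m : Fin d → ℤ}
    (hm : symD k T m μ = 0) : eigenspace (operatorL k γ σ S) μ ≠ ⊥ := by
  classical
  obtain ⟨e⟩ := nonempty_eigenspace_equiv (k := k) hS hT hT0 hT1 hμ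
  obtain ⟨v, hv, hv0⟩ := (Submodule.ne_bot_iff _).mp (symKer_ne_bot hm)
  intro hbot
  have h1 := hbot.le (e.symm (Pi.single ⟨m, hm⟩ ⟨v, hv⟩)).2
  rw [Submodule.mem_bot] at h1
  have h2 : e.symm (Pi.single ⟨m, hm⟩ ⟨v, hv⟩) = 0 := Subtype.ext h1
  rw [LinearEquiv.map_eq_zero_iff, Pi.single_eq_zero_iff] at h2
  exact hv0 (congrArg Subtype.val h2)

theorem finrank_eigenspace (hS : ∫ z, S z * S z = (κ : ℂ))
    (hT : ∀ m, ((γ : ℂ) * ((2 * Real.pi : ℂ) ^ d * coeff (fun x => (σ x : ℂ)) m)) ^ 2 * κ = T m)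
    (hT0 : ∀ m, 0 ≤ T m) (hT1 : ∀ m, T m < 1 / 4) {μ : ℂ} (hμ : μ ≠ 1 / 2)
    (h : ∀ m : Fin d → ℤ, symA m μ ≠ 0 ∨ symB T m μ ≠ 0) :
    Module.finrank ℂ (eigenspace (operatorL k γ σ S) μ) = {m | symD k T m μ = 0}.ncard := by
  have : Fintype {m | symD k T m μ = 0} := (finite_symD_eq_zero k hT0 hT1 μ).fintype
  obtain ⟨e⟩ := nonempty_eigenspace_equiv (k := k) hS hT hT0 hT1 hμ
  have h1 : ∀ m : {m | symD k T m μ = 0}, Module.finrank ℂ (symKer k T m.1 μ) = 1 :=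
    fun m => finrank_symKer m.2 (h m.1)
  rw [e.finrank_eq, Module.finrank_pi_fintype]
  simp_rw [h1]
  rw [Finset.sum_const, smul_eq_mul, mul_one, Finset.card_univ, ← Nat.card_eq_fintype_card,
    Nat.card_coe_set_eq]

/-! ### The resolvent -/

/-- The convolution is continuous on `L²(𝕋^d)`. -/
theorem exists_convolution_eq (σ : C(Torus d, ℝ)) :
    ∃ C : L2Torus d →L[ℂ] L2Torus d, ∀ q, convolution σ q = C q := by
  obtain ⟨C, hC⟩ := exists_boundedMultiplier (norm_two_pi_pow_mul_coeff_le σ)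
  exact ⟨C, fun q => ext_coeff fun m => by rw [coeff_convolution, hC]⟩

theorem exists_multiplier_sobolevTwo {a : (Fin d → ℤ) → ℂ} {C : ℝ}
    (ha : ∀ m, (1 + ((m ⬝ᵥ m : ℤ) : ℝ)) * ‖a m‖ ≤ C) :
    ∃ T : L2Torus d →L[ℂ] L2Torus d, (∀ q m, coeff (T q) m = a m * coeff q m) ∧
      ∀ q, T q ∈ sobolevTwo d := by
  obtain ⟨T, hT⟩ := exists_boundedMultiplier (a := a) (C := C) fun m => by
    have h1 := dotProduct_self_nonneg_real m
    refine le_trans ?_ (ha m)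
    nlinarith [norm_nonneg (a m)]
  refine ⟨T, hT, fun q => mem_sobolevTwo_of_norm_coeff_le (r := q) (C := C) fun m => ?_⟩
  rw [hT, norm_mul, ← mul_assoc]
  exact mul_le_mul_of_nonneg_right (ha m) (norm_nonneg _)

/-- The first component of a Hilbert product. -/
def fstCLM (E F : Type*) [NormedAddCommGroup E] [NormedSpace ℂ E] [NormedAddCommGroup F]
    [NormedSpace ℂ F] : WithLp 2 (E × F) →L[ℂ] E :=
  (ContinuousLinearMap.fst ℂ E F).comp
    (WithLp.prodContinuousLinearEquiv 2 ℂ E F : WithLp 2 (E × F) →L[ℂ] E × F)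

/-- The second component of a Hilbert product. -/
def sndCLM (E F : Type*) [NormedAddCommGroup E] [NormedSpace ℂ E] [NormedAddCommGroup F]
    [NormedSpace ℂ F] : WithLp 2 (E × F) →L[ℂ] F :=
  (ContinuousLinearMap.snd ℂ E F).comp
    (WithLp.prodContinuousLinearEquiv 2 ℂ E F : WithLp 2 (E × F) →L[ℂ] E × F)

/-- The operator into a Hilbert product with given components. -/
def pairCLM {E F G : Type*} [NormedAddCommGroup E] [NormedSpace ℂ E] [NormedAddCommGroup F]
    [NormedSpace ℂ F] [NormedAddCommGroup G] [NormedSpace ℂ G] (f : G →L[ℂ] E) (g : G →L[ℂ] F) :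
    G →L[ℂ] WithLp 2 (E × F) :=
  ((WithLp.prodContinuousLinearEquiv 2 ℂ E F).symm : E × F →L[ℂ] WithLp 2 (E × F)).comp (f.prod g)

/-- Each mode is inverted by Cramer's rule. The entries of the inverses are `O(1/(1 + m²))`, so they
define bounded multipliers with values in `H²`, and the fields are recovered from `q`. -/
theorem mem_resolventSet_of_symD_ne_zero (hS : ∫ z, S z * S z = (κ : ℂ))
    (hT : ∀ m, ((γ : ℂ) * ((2 * Real.pi : ℂ) ^ d * coeff (fun x => (σ x : ℂ)) m)) ^ 2 * κ = T m)
    (hT0 : ∀ m, 0 ≤ T m) (hT1 : ∀ m, T m < 1 / 4) {μ : ℂ} (hμ : μ ≠ 1 / 2)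
    (hD : ∀ m, symD k T m μ ≠ 0) : μ ∈ resolventSet (operatorL k γ σ S) := by
  obtain ⟨C, hC⟩ := exists_norm_div_symD_le k hT0 hT1 hD
  obtain ⟨MA, hMA, hMA2⟩ := exists_multiplier_sobolevTwo fun m => (hC m).1
  obtain ⟨MB, hMB, hMB2⟩ := exists_multiplier_sobolevTwo fun m => (hC m).2.1
  obtain ⟨MI, hMI, hMI2⟩ := exists_multiplier_sobolevTwo fun m => (hC m).2.2
  obtain ⟨Cv, hCv⟩ := exists_convolution_eq σ
  let F := fstCLM (WithLp 2 (L2Torus d × L2Torus d)) (WithLp 2 (L2Field d n × L2Field d n))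
  let G := sndCLM (WithLp 2 (L2Torus d × L2Torus d)) (WithLp 2 (L2Field d n × L2Field d n))
  let Y1 : StateSpace d n →L[ℂ] L2Torus d := (fstCLM _ _).comp F
  let Y2 : StateSpace d n →L[ℂ] L2Torus d := (sndCLM _ _).comp F
  let Y3 : StateSpace d n →L[ℂ] L2Field d n := (fstCLM _ _).comp G
  let Y4 : StateSpace d n →L[ℂ] L2Field d n := (sndCLM _ _).comp G
  let W : StateSpace d n →L[ℂ] L2Torus d :=
    Y1 - ((γ : ℂ) * (1 / 2 - μ)⁻¹) • Cv.comp ((fieldAverage S).comp Y3)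
  let Q : StateSpace d n →L[ℂ] L2Torus d := MA.comp W - MI.comp Y2
  let P : StateSpace d n →L[ℂ] L2Torus d := MI.comp W + MB.comp Y2
  let Φ : StateSpace d n →L[ℂ] L2Field d n :=
    (1 / 2 - μ)⁻¹ • (Y3 - (γ : ℂ) • (tensorField S).comp (Cv.comp Q))
  let R : StateSpace d n →L[ℂ] StateSpace d n :=
    pairCLM (pairCLM Q P) (pairCLM Φ ((1 / 2 - μ)⁻¹ • Y4))
  have hdom : ∀ Y, R Y ∈ domainL d n := fun Y =>
    ⟨sub_mem (hMA2 _) (hMI2 _), add_mem (hMI2 _) (hMB2 _)⟩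
  have hR : ∀ Y, operatorL k γ σ S ⟨R Y, hdom Y⟩ - μ • R Y = Y := by
    intro Y
    refine (operatorL_sub_smul_eq_iff_coeff hS hT hμ ⟨R Y, hdom Y⟩ Y).mpr ⟨fun m => ?_, ?_, rfl⟩
    · have hw : coeff (Y.fst.fst - ((γ : ℂ) * (1 / 2 - μ)⁻¹) •
          convolution σ (fieldAverage S Y.snd.fst) : L2Torus d) m = coeff (W Y) m := by
        rw [hCv]
        rfl
      have hq : coeff (R Y).fst.fst m = symA m μ / symD k T m μ * coeff (W Y) m
          - Complex.I * ((k ⬝ᵥ m : ℤ) : ℂ) / symD k T m μ * coeff Y.fst.snd m := by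
        rw [← hMA, ← hMI, ← coeff_sub]
        rfl
      have hp : coeff (R Y).fst.snd m
          = Complex.I * ((k ⬝ᵥ m : ℤ) : ℂ) / symD k T m μ * coeff (W Y) m
          + symB T m μ / symD k T m μ * coeff Y.fst.snd m := by
        rw [← hMB, ← hMI, ← coeff_add]
        rfl
      have hDm := hD m
      rw [hw]
      change symB T m μ * coeff (R Y).fst.fst m
          + Complex.I * ((k ⬝ᵥ m : ℤ) : ℂ) * coeff (R Y).fst.snd m = coeff (W Y) m ∧
        symA m μ * coeff (R Y).fst.snd m
          - Complex.I * ((k ⬝ᵥ m : ℤ) : ℂ) * coeff (R Y).fst.fst m = coeff Y.fst.snd m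
      rw [hq, hp]
      have hdet : symA m μ * symB T m μ + (Complex.I * ((k ⬝ᵥ m : ℤ) : ℂ)) ^ 2 = symD k T m μ := by
        rw [symD, mul_pow, Complex.I_sq]
        ring
      generalize Complex.I * ((k ⬝ᵥ m : ℤ) : ℂ) = b at *
      generalize symD k T m μ = D at *
      constructor
      · field_simp
        linear_combination coeff (W Y) m * hdet
      · field_simp
        linear_combination coeff Y.fst.snd m * hdet
    · rw [hCv]
      rfl
  refine ⟨R, fun Y => ⟨hdom Y, hR Y⟩, fun X => ?_⟩
  set Y := operatorL k γ σ S X - μ • (X : StateSpace d n) with hY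
  -- The right inverse is also a left inverse: `R Y - X` solves the homogeneous equation, and with
  -- no singular mode the eigenspace is zero.
  have h1 : R Y - (X : StateSpace d n) ∈ eigenspace (operatorL k γ σ S) μ := by
    refine mem_eigenspace.mpr ⟨sub_mem (hdom Y) X.2, ?_⟩
    have h2 : (⟨R Y - (X : StateSpace d n), sub_mem (hdom Y) X.2⟩ :
        (operatorL k γ σ S).domain) = ⟨R Y, hdom Y⟩ - X := rfl
    rw [h2, LinearPMap.map_sub, smul_sub, sub_sub_sub_comm, hR, ← hY, sub_self]
  obtain ⟨e⟩ := nonempty_eigenspace_equiv (k := k) hS hT hT0 hT1 hμ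
  have h3 : (⟨_, h1⟩ : eigenspace (operatorL k γ σ S) μ) = 0 :=
    e.injective (funext fun m => absurd m.2 (hD m.1))
  exact sub_eq_zero.mp (congrArg Subtype.val h3)

/-- For `μ ≠ 1/2`, the spectrum consists of the zeros of the determinant of the reduced symbol. -/
theorem exists_symD_eq_zero_of_mem_unboundedSpectrum (hS : ∫ z, S z * S z = (κ : ℂ))
    (hT : ∀ m, ((γ : ℂ) * ((2 * Real.pi : ℂ) ^ d * coeff (fun x => (σ x : ℂ)) m)) ^ 2 * κ = T m)
    (hT0 : ∀ m, 0 ≤ T m) (hT1 : ∀ m, T m < 1 / 4) {μ : ℂ} (hμ : μ ≠ 1 / 2)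
    (h : μ ∈ unboundedSpectrum (operatorL k γ σ S)) : ∃ m, symD k T m μ = 0 := by
  by_contra! hD
  exact h (mem_resolventSet_of_symD_ne_zero hS hT hT0 hT1 hμ hD)

/-- The component `π` is coupled to nothing, so every `(0, 0, 0, π)` satisfies the eigenvalue
equation. -/
theorem not_finiteDimensional_eigenspace_half (hn : 0 < n) :
    ¬ FiniteDimensional ℂ (eigenspace (operatorL k γ σ S) (1 / 2)) := by
  intro hfin
  let Ψ : L2Field d n →ₗ[ℂ] eigenspace (operatorL k γ σ S) (1 / 2) :=
    { toFun := fun π => ⟨mkState 0 0 0 π, by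
        refine mem_eigenspace.mpr ⟨⟨zero_mem _, zero_mem _⟩, ?_⟩
        refine (operatorL_sub_smul_eq_iff k γ σ S _ ⟨mkState 0 0 0 π, zero_mem _, zero_mem _⟩
          0).mpr ⟨?_, ?_, ?_, ?_⟩
        · change -((1 / 2 : ℂ) • laplacian d 0) + dotGradient k 0
            + (γ : ℂ) • convolution σ (fieldAverage S 0) - (1 / 2 : ℂ) • 0 = (0 : L2Torus d)
          simp only [map_zero, smul_zero, neg_zero, add_zero, sub_zero]
        · change -((1 / 2 : ℂ) • laplacian d 0) - dotGradient k 0 - (1 / 2 : ℂ) • 0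
            = (0 : L2Torus d)
          simp only [map_zero, smul_zero, neg_zero, sub_zero]
        · change (1 / 2 : ℂ) • (0 : L2Field d n) + (γ : ℂ) • tensorField S (convolution σ 0)
            - (1 / 2 : ℂ) • (0 : L2Field d n) = 0
          simp only [map_zero, smul_zero, add_zero, sub_zero]
        · exact sub_self _⟩
      map_add' := fun π ρ => Subtype.ext (stateSpace_ext (add_zero _).symm (add_zero _).symm
        (add_zero _).symm rfl)
      map_smul' := fun t π => Subtype.ext (stateSpace_ext (smul_zero _).symm (smul_zero _).symm
        (smul_zero _).symm rfl) }
  refine not_finiteDimensional_L2Field (d := d) hn (FiniteDimensional.of_injective Ψ ?_)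
  intro π ρ h
  exact congrArg (fun X : eigenspace (operatorL k γ σ S) (1 / 2) => X.1.snd.snd) h

theorem essentialSpectrum_operatorL (hn : 0 < n) (hS : ∫ z, S z * S z = (κ : ℂ))
    (hT : ∀ m, ((γ : ℂ) * ((2 * Real.pi : ℂ) ^ d * coeff (fun x => (σ x : ℂ)) m)) ^ 2 * κ = T m)
    (hT0 : ∀ m, 0 ≤ T m) (hT1 : ∀ m, T m < 1 / 4) :
    essentialSpectrum (operatorL k γ σ S) = {1 / 2} := by
  ext μ
  rw [Set.mem_singleton_iff]
  constructor
  · rintro ⟨hspec, hness⟩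
    by_contra hμ
    obtain ⟨m, hm⟩ := exists_symD_eq_zero_of_mem_unboundedSpectrum hS hT hT0 hT1 hμ hspec
    obtain ⟨ε, hε, h⟩ := isolated_zeros_symD k hT0 hT1 hμ
    refine hness ⟨⟨ε, hε, fun ν hν hνμ => ?_⟩,
      eigenspace_ne_bot_of_symD_eq_zero hS hT hT0 hT1 hμ hm,
      finiteDimensional_eigenspace hS hT hT0 hT1 hμ⟩
    obtain ⟨h1, h2⟩ := h ν hνμ
    exact h2 (exists_symD_eq_zero_of_mem_unboundedSpectrum hS hT hT0 hT1 h1 hν)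
  · rintro rfl
    refine ⟨mem_unboundedSpectrum_of_eigenspace_ne_bot fun hbot => ?_,
      fun h => not_finiteDimensional_eigenspace_half hn h.2.2⟩
    refine not_finiteDimensional_eigenspace_half (k := k) (γ := γ) (σ := σ) (S := S) hn ?_
    rw [hbot]
    infer_instance

end Operator

/-! ### Zeros of the determinant on `(-∞, 0]` -/

section Counting

variable {d : ℕ} {k : Fin d → ℤ} {T : (Fin d → ℤ) → ℝ}

theorem symA_ofReal (m : Fin d → ℤ) (μ : ℝ) :
    symA m (μ : ℂ) = ((((m ⬝ᵥ m : ℤ) : ℝ) / 2 - μ : ℝ) : ℂ) := by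
  rw [symA]
  push_cast
  rfl

theorem symB_ofReal (m : Fin d → ℤ) (μ : ℝ) :
    symB T m (μ : ℂ) = ((((m ⬝ᵥ m : ℤ) : ℝ) / 2 - μ - T m / (1 / 2 - μ) : ℝ) : ℂ) := by
  rw [symB, symA]
  push_cast
  rfl

theorem symD_ofReal_eq_zero_iff {m : Fin d → ℤ} {μ : ℝ} (h : ((m ⬝ᵥ m : ℤ) : ℝ) / 2 - μ ≠ 0) :
    symD k T m (μ : ℂ) = 0 ↔
      schurComplement ((m ⬝ᵥ m : ℤ) : ℝ) ((k ⬝ᵥ m : ℤ) : ℝ) (T m) μ = 0 := by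
  have h1 : symD k T m (μ : ℂ) = (((((m ⬝ᵥ m : ℤ) : ℝ) / 2 - μ) *
      schurComplement ((m ⬝ᵥ m : ℤ) : ℝ) ((k ⬝ᵥ m : ℤ) : ℝ) (T m) μ : ℝ) : ℂ) := by
    rw [symD, symA_ofReal, symB_ofReal, ← Complex.ofReal_intCast (k ⬝ᵥ m), ← Complex.ofReal_mul,
      ← Complex.ofReal_pow, ← Complex.ofReal_sub]
    congr 1
    have h2 := mul_div_cancel₀ (((k ⬝ᵥ m : ℤ) : ℝ) ^ 2) h
    rw [schurComplement]
    linear_combination h2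
  rw [h1, Complex.ofReal_eq_zero, mul_eq_zero, or_iff_right h]

theorem one_le_dotProduct_self {m : Fin d → ℤ} (hm : m ≠ 0) : 1 ≤ m ⬝ᵥ m := by
  have h1 : 0 ≤ m ⬝ᵥ m := Finset.sum_nonneg fun j _ => mul_self_nonneg (m j)
  have h2 : m ⬝ᵥ m ≠ 0 := fun h => hm (dotProduct_self_eq_zero.mp h)
  omega

/-! ### Sign of the Schur complement at zero -/

theorem schurComplement_zero {a : ℝ} (ha : a ≠ 0) (b t : ℝ) :
    schurComplement a b t 0 = (a ^ 2 - 4 * b ^ 2 - 4 * t * a) / (2 * a) := by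
  simp only [schurComplement, sub_zero]
  field_simp
  ring

/-- The sign is that of `a² - 4b² - 4ta`. If `a² - 4b² > 0`, integrality gives `a² - 4b² ≥ a > 4ta`,
so the coupling cannot change the sign; it matters only when `a² = 4b²`. -/
theorem schurComplement_zero_neg_iff {a b : ℤ} {t : ℝ} (ha : 1 ≤ a) (ht0 : 0 ≤ t)
    (ht1 : t < 1 / 4) : schurComplement a b t 0 < 0 ↔
      (a ^ 2 - 4 * b ^ 2 < 0 ∧ t = 0) ∨ (a ^ 2 - 4 * b ^ 2 ≤ 0 ∧ t ≠ 0) := by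
  have ha' : (1 : ℝ) ≤ a := by exact_mod_cast ha
  rw [schurComplement_zero (by linarith), div_lt_iff₀ (by linarith), zero_mul]
  rcases ht0.eq_or_lt with h | h
  · subst h
    simp only [mul_zero, zero_mul, sub_zero, ne_eq, not_true_eq_false, and_false, or_false,
      and_true]
    exact_mod_cast Iff.rfl
  · simp only [h.ne', and_false, false_or, ne_eq, not_false_eq_true, and_true]
    constructor
    · intro h1
      by_contra! h2
      have h3 : (a : ℝ) ≤ a ^ 2 - 4 * b ^ 2 := by exact_mod_cast le_sq_sub_four_mul_sq ha h2
      nlinarith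
    · intro h1
      have h2 : (a : ℝ) ^ 2 - 4 * b ^ 2 ≤ 0 := by exact_mod_cast h1
      nlinarith

theorem schurComplement_zero_eq_zero_iff {a b : ℤ} {t : ℝ} (ha : 1 ≤ a) (ht0 : 0 ≤ t)
    (ht1 : t < 1 / 4) : schurComplement a b t 0 = 0 ↔ a ^ 2 - 4 * b ^ 2 = 0 ∧ t = 0 := by
  have ha' : (1 : ℝ) ≤ a := by exact_mod_cast ha
  rw [schurComplement_zero (by linarith), div_eq_zero_iff, or_iff_left (by linarith)]
  constructor
  · intro h
    have h4 : 0 ≤ 4 * t * (a : ℝ) := by positivity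
    have h5 : ¬ 0 < a ^ 2 - 4 * b ^ 2 := by
      intro h2
      have h3 : (a : ℝ) ≤ a ^ 2 - 4 * b ^ 2 := by exact_mod_cast le_sq_sub_four_mul_sq ha h2
      nlinarith
    have h6 : (a : ℝ) ^ 2 - 4 * b ^ 2 ≤ 0 := by exact_mod_cast not_lt.mp h5
    have h7 : (a : ℝ) ^ 2 - 4 * b ^ 2 = 0 := by linarith
    refine ⟨by exact_mod_cast h7, ?_⟩
    rw [h7, zero_sub, neg_eq_zero] at h
    have h8 := (mul_eq_zero.mp h).resolve_right (by linarith)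
    linarith
  · rintro ⟨h1, rfl⟩
    have h2 : (a : ℝ) ^ 2 - 4 * b ^ 2 = 0 := by exact_mod_cast h1
    rw [h2]
    ring

/-- The frequencies with `m⁴ ≤ 4 (k · m)²` are finitely many. -/
theorem finite_sq_sub_nonpos (k : Fin d → ℤ) :
    {m : Fin d → ℤ | (m ⬝ᵥ m) ^ 2 - 4 * (k ⬝ᵥ m) ^ 2 ≤ 0}.Finite := by
  refine (finite_dotProduct_self_le (4 * ((k ⬝ᵥ k : ℤ) : ℝ))).subset fun m hm => ?_
  have h1 : (((m ⬝ᵥ m : ℤ) : ℝ)) ^ 2 - 4 * ((k ⬝ᵥ m : ℤ) : ℝ) ^ 2 ≤ 0 := by exact_mod_cast hm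
  have h2 := dotProduct_sq_le k m
  have h3 := dotProduct_self_nonneg_real m
  have h4 := dotProduct_self_nonneg_real k
  rw [Set.mem_ofPred_eq]
  by_contra! h5
  nlinarith

/-- The frequencies contributing a negative eigenvalue. -/
def negativeModes (k : Fin d → ℤ) (T : (Fin d → ℤ) → ℝ) : Set (Fin d → ℤ) :=
  {m | schurComplement ((m ⬝ᵥ m : ℤ) : ℝ) ((k ⬝ᵥ m : ℤ) : ℝ) (T m) 0 < 0}

theorem negativeModes_eq (hT0 : ∀ m, 0 ≤ T m) (hT1 : ∀ m, T m < 1 / 4) (hT00 : 0 < T 0) :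
    negativeModes k T = insert 0
      ({m | m ≠ 0 ∧ (m ⬝ᵥ m) ^ 2 - 4 * (k ⬝ᵥ m) ^ 2 < 0 ∧ T m = 0} ∪
        {m | m ≠ 0 ∧ (m ⬝ᵥ m) ^ 2 - 4 * (k ⬝ᵥ m) ^ 2 ≤ 0 ∧ T m ≠ 0}) := by
  ext m
  by_cases hm : m = 0
  · subst hm
    simp only [Set.mem_insert_iff, true_or, iff_true]
    -- At `m = 0` the last fraction is `0 / 0 = 0`, and the value is `-2 T(0)`.
    simp only [negativeModes, Set.mem_ofPred_eq, schurComplement, dotProduct_zero]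
    norm_num
    exact hT00
  · simp only [Set.mem_insert_iff, hm, false_or, Set.mem_union, Set.mem_ofPred_eq, ne_eq,
      not_false_eq_true, true_and]
    exact schurComplement_zero_neg_iff (one_le_dotProduct_self hm) (hT0 m) (hT1 m)

theorem finite_negativeModes (hT0 : ∀ m, 0 ≤ T m) (hT1 : ∀ m, T m < 1 / 4) (hT00 : 0 < T 0) :
    (negativeModes k T).Finite := by
  rw [negativeModes_eq hT0 hT1 hT00]
  refine ((finite_sq_sub_nonpos k).subset ?_).insert 0
  rintro m (h | h)
  · exact h.2.1.le
  · exact h.2.1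

theorem half_sub_ne_zero (m : Fin d → ℤ) {μ : ℝ} (hμ : μ < 0) :
    ((m ⬝ᵥ m : ℤ) : ℝ) / 2 - μ ≠ 0 := by
  have := dotProduct_self_nonneg_real m
  linarith

theorem dotProduct_eq_zero_of_self (m : Fin d → ℤ) (h : ((m ⬝ᵥ m : ℤ) : ℝ) = 0) :
    ((k ⬝ᵥ m : ℤ) : ℝ) = 0 := by
  have h1 : m = 0 := dotProduct_self_eq_zero.mp (by exact_mod_cast h)
  rw [h1, dotProduct_zero, Int.cast_zero]

/-- Each frequency of `negativeModes` contributes exactly one negative zero of the determinant, and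
the other ones none. -/
theorem exists_root (k : Fin d → ℤ) (hT0 : ∀ m, 0 ≤ T m) :
    ∃ r : (Fin d → ℤ) → ℝ, ∀ m (μ : ℝ), (μ < 0 ∧ symD k T m (μ : ℂ) = 0) ↔
      (m ∈ negativeModes k T ∧ μ = r m) := by
  have h : ∀ m : Fin d → ℤ, ∃ x : ℝ, m ∈ negativeModes k T → x < 0 ∧
      schurComplement ((m ⬝ᵥ m : ℤ) : ℝ) ((k ⬝ᵥ m : ℤ) : ℝ) (T m) x = 0 := by
    intro m
    by_cases hm : m ∈ negativeModes k T
    · obtain ⟨x, hx, hx0⟩ := exists_schurComplement_eq_zero (dotProduct_self_nonneg_real m)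
        (hT0 m) (dotProduct_eq_zero_of_self m) hm
      exact ⟨x, fun _ => ⟨hx, hx0⟩⟩
    -- The value `0` off the negative modes is arbitrary and never used.
    · exact ⟨0, fun h => absurd h hm⟩
  choose r hr using h
  have hanti := fun (m : Fin d → ℤ) {μ ν : ℝ} => schurComplement_strictAnti (μ := μ) (ν := ν)
    (dotProduct_self_nonneg_real m) (hT0 m) (dotProduct_eq_zero_of_self (k := k) m)
  refine ⟨r, fun m μ => ⟨?_, ?_⟩⟩
  · rintro ⟨hμ, h0⟩
    rw [symD_ofReal_eq_zero_iff (half_sub_ne_zero m hμ)] at h0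
    have hm : m ∈ negativeModes k T := by
      have := hanti m hμ le_rfl
      rw [h0] at this
      exact this
    obtain ⟨hx, hx0⟩ := hr m hm
    refine ⟨hm, ?_⟩
    rcases lt_trichotomy μ (r m) with h1 | h1 | h1
    · have := hanti m h1 hx.le
      rw [h0, hx0] at this
      exact absurd this (lt_irrefl _)
    · exact h1
    · have := hanti m h1 hμ.le
      rw [h0, hx0] at this
      exact absurd this (lt_irrefl _)
  · rintro ⟨hm, rfl⟩
    obtain ⟨hx, hx0⟩ := hr m hm
    exact ⟨hx, (symD_ofReal_eq_zero_iff (half_sub_ne_zero m hx)).mpr hx0⟩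

theorem symD_zero_eq_zero (hT0 : ∀ m, 0 ≤ T m) (hT1 : ∀ m, T m < 1 / 4) :
    {m | symD k T m 0 = 0} = insert 0
      {m | m ≠ 0 ∧ (m ⬝ᵥ m) ^ 2 - 4 * (k ⬝ᵥ m) ^ 2 = 0 ∧ T m = 0} := by
  ext m
  by_cases hm : m = 0
  · subst hm
    simp [symD, symA]
  · have ha := one_le_dotProduct_self hm
    have ha' : (1 : ℝ) ≤ ((m ⬝ᵥ m : ℤ) : ℝ) := by exact_mod_cast ha
    simp only [Set.mem_insert_iff, hm, false_or, Set.mem_ofPred_eq, ne_eq, not_false_eq_true,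
      true_and]
    have h := symD_ofReal_eq_zero_iff (k := k) (T := T) (m := m) (μ := 0) (by linarith)
    rw [Complex.ofReal_zero] at h
    rw [h]
    exact schurComplement_zero_eq_zero_iff ha (hT0 m) (hT1 m)

end Counting

/-! ### The negative eigenvalues and the kernel -/

section Index

variable {d n : ℕ} {k : Fin d → ℤ} {γ : ℝ} {σ : C(Torus d, ℝ)} {S : L2Space n} {κ : ℝ}
  {T : (Fin d → ℤ) → ℝ}

theorem ofReal_ne_half {μ : ℝ} (hμ : μ ≤ 0) : (μ : ℂ) ≠ 1 / 2 := by
  intro h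
  have h1 := congrArg Complex.re h
  norm_num at h1
  linarith

theorem mem_negativeEigenvalues_iff (hS : ∫ z, S z * S z = (κ : ℂ))
    (hT : ∀ m, ((γ : ℂ) * ((2 * Real.pi : ℂ) ^ d * coeff (fun x => (σ x : ℂ)) m)) ^ 2 * κ = T m)
    (hT0 : ∀ m, 0 ≤ T m) (hT1 : ∀ m, T m < 1 / 4) {μ : ℝ} :
    μ ∈ negativeEigenvalues (operatorL k γ σ S) ↔ μ < 0 ∧ ∃ m, symD k T m (μ : ℂ) = 0 := by
  refine and_congr_right fun hμ => ⟨fun h => ?_, fun ⟨m, hm⟩ => ?_⟩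
  · exact exists_symD_eq_zero_of_mem_unboundedSpectrum hS hT hT0 hT1 (ofReal_ne_half hμ.le)
      (mem_unboundedSpectrum_of_eigenspace_ne_bot h)
  · exact eigenspace_ne_bot_of_symD_eq_zero hS hT hT0 hT1 (ofReal_ne_half hμ.le) hm

/-- For `μ < 0` the entry `A` is positive, so each singular mode contributes a line. Several modes
may share an eigenvalue; its multiplicity is the size of the fibre of the root map, and the fibres
add up to the set of negative modes. -/
theorem negativeEigenvalues_finite_and_negativeIndex (hS : ∫ z, S z * S z = (κ : ℂ))
    (hT : ∀ m, ((γ : ℂ) * ((2 * Real.pi : ℂ) ^ d * coeff (fun x => (σ x : ℂ)) m)) ^ 2 * κ = T m)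
    (hT0 : ∀ m, 0 ≤ T m) (hT1 : ∀ m, T m < 1 / 4) (hT00 : 0 < T 0) :
    (negativeEigenvalues (operatorL k γ σ S)).Finite ∧
      negativeIndex (operatorL k γ σ S) = (negativeModes k T).ncard := by
  classical
  obtain ⟨r, hr⟩ := exists_root k hT0
  have hfin := finite_negativeModes (k := k) hT0 hT1 hT00
  have hset : negativeEigenvalues (operatorL k γ σ S) = ↑(hfin.toFinset.image r) := by
    ext μ
    rw [mem_negativeEigenvalues_iff hS hT hT0 hT1, Finset.coe_image, hfin.coe_toFinset]
    constructor
    · rintro ⟨hμ, m, hm⟩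
      obtain ⟨h1, h2⟩ := (hr m μ).mp ⟨hμ, hm⟩
      exact ⟨m, h1, h2.symm⟩
    · rintro ⟨m, hm, rfl⟩
      obtain ⟨h1, h2⟩ := (hr m (r m)).mpr ⟨hm, rfl⟩
      exact ⟨h1, m, h2⟩
  refine ⟨hset ▸ Finset.finite_toSet _, ?_⟩
  rw [negativeIndex, hset, finsum_mem_coe_finset, Set.ncard_eq_toFinset_card _ hfin,
    Finset.card_eq_sum_card_image r]
  refine Finset.sum_congr rfl fun μ hμ => ?_
  have hneg : μ < 0 := by
    have h1 : μ ∈ negativeEigenvalues (operatorL k γ σ S) := hset ▸ hμ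
    exact h1.1
  rw [finrank_eigenspace hS hT hT0 hT1 (ofReal_ne_half hneg.le) fun m => Or.inl ?_,
    ← Set.ncard_coe_finset]
  · congr 1
    ext m
    rw [Finset.coe_filter, Set.mem_ofPred_eq, Set.mem_ofPred_eq, hfin.mem_toFinset]
    constructor
    · intro h
      obtain ⟨h1, h2⟩ := (hr m μ).mp ⟨hneg, h⟩
      exact ⟨h1, h2.symm⟩
    · rintro ⟨h1, h2⟩
      exact ((hr m μ).mpr ⟨h1, h2.symm⟩).2
  · rw [symA_ofReal]
    exact Complex.ofReal_ne_zero.mpr (half_sub_ne_zero m hneg)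

/-- At `μ = 0` the entry `A` vanishes only for `m = 0`, where `B = -2 T(0) ≠ 0`. So every singular
mode contributes a line. -/
theorem finrank_kernel (hS : ∫ z, S z * S z = (κ : ℂ))
    (hT : ∀ m, ((γ : ℂ) * ((2 * Real.pi : ℂ) ^ d * coeff (fun x => (σ x : ℂ)) m)) ^ 2 * κ = T m)
    (hT0 : ∀ m, 0 ≤ T m) (hT1 : ∀ m, T m < 1 / 4) (hT00 : 0 < T 0) :
    Module.finrank ℂ (eigenspace (operatorL k γ σ S) 0) = {m | symD k T m 0 = 0}.ncard := by
  refine finrank_eigenspace hS hT hT0 hT1 (by norm_num) fun m => ?_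
  by_cases hm : m = 0
  · right
    subst hm
    rw [symB, symA]
    simpa using hT00.ne'
  · left
    rw [symA]
    have := one_le_dotProduct_self hm
    simp only [sub_zero, ne_eq, div_eq_zero_iff, OfNat.ofNat_ne_zero, or_false]
    exact_mod_cast (by omega : m ⬝ᵥ m ≠ 0)

theorem vectorXZero_mem_kernel (hS : ∫ z, S z * S z = (κ : ℂ))
    (hT : ∀ m, ((γ : ℂ) * ((2 * Real.pi : ℂ) ^ d * coeff (fun x => (σ x : ℂ)) m)) ^ 2 * κ = T m) :
    vectorXZero d n ∈ eigenspace (operatorL k γ σ S) 0 := by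
  refine (mem_eigenspace_operatorL hS hT (by norm_num)).mpr
    ⟨⟨zero_mem _, characterL2_mem_sobolevTwo 0⟩, fun m => ?_, ?_, rfl⟩
  · change (coeff (0 : L2Torus d) m, coeff (characterL2 0) m) ∈ _
    rw [coeff_zero, coeff_characterL2]
    split_ifs with h
    · subst h
      refine ⟨?_, ?_⟩ <;> simp [symA]
    · exact zero_mem _
  · change (0 : L2Field d n) = (1 / 2 - 0 : ℂ)⁻¹ • -((γ : ℂ) • tensorField S (convolution σ 0))
    rw [map_zero, map_zero, smul_zero, neg_zero, smul_zero]

end Index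

end SchrodingerWave

end

/-! ### Verification of the bounds on the coupling, and conclusion -/

theorem mainTheorem6 {d n : ℕ} (hn : 3 ≤ n) (k : Fin d → ℤ) (γ : ℝ) (hγ : 0 < γ)
    (σ₁ : C(SchrodingerWave.Torus d, ℝ))
    (σ₂ : EuclideanSpace ℝ (Fin n) → ℝ)
    (hσ₁_nonneg : ∀ x, 0 ≤ σ₁ x)
    (hσ₁_smooth : ContDiff ℝ ∞ fun x : Fin d → ℝ =>
      σ₁ fun j => (x j : AddCircle (2 * Real.pi)))
    (hσ₁_even : ∀ x, σ₁ (-x) = σ₁ x)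
    (hσ₁_mean : ∫ x, σ₁ x ≠ 0)
    (hσ₂_nonneg : ∀ z, 0 ≤ σ₂ z)
    (hσ₂_smooth : ContDiff ℝ ∞ σ₂)
    (hσ₂_radial : ∀ z w, ‖z‖ = ‖w‖ → σ₂ z = σ₂ w)
    (hσ₂_supp : HasCompactSupport σ₂)
    (hσ₂_riesz : MemLp (SchrodingerWave.rieszSymbol σ₂) 2 volume)
    (hσ₂_fourier : ∀ ξ, 𝓕 (fun z => (σ₂ z : ℂ)) ξ ≠ 0)
    (hsmall : 4 * γ ^ 2 * SchrodingerWave.kappa σ₂ * (∫ x, |σ₁ x|) ^ 2 < 1) :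
    let S := SchrodingerWave.invSqrtLaplacian σ₂ hσ₂_riesz
    let L := SchrodingerWave.operatorL k γ σ₁ S
    let c : (Fin d → ℤ) → ℂ := SchrodingerWave.coeff fun x => (σ₁ x : ℂ)
    let A : Set (Fin d → ℤ) := {m | m ≠ 0 ∧ (m ⬝ᵥ m) ^ 2 - 4 * (k ⬝ᵥ m) ^ 2 < 0 ∧ c m = 0}
    let B : Set (Fin d → ℤ) := {m | m ≠ 0 ∧ (m ⬝ᵥ m) ^ 2 - 4 * (k ⬝ᵥ m) ^ 2 ≤ 0 ∧ c m ≠ 0}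
    let K : Set (Fin d → ℤ) := {m | m ≠ 0 ∧ (m ⬝ᵥ m) ^ 2 - 4 * (k ⬝ᵥ m) ^ 2 = 0 ∧ c m = 0}
    SchrodingerWave.essentialSpectrum L = {1 / 2} ∧
    ((SchrodingerWave.negativeEigenvalues L).Finite ∧
      (∀ μ ∈ SchrodingerWave.negativeEigenvalues L,
        FiniteDimensional ℂ (SchrodingerWave.eigenspace L (μ : ℂ))) ∧
      A.Finite ∧ B.Finite ∧
      SchrodingerWave.negativeIndex L = 1 + A.ncard + B.ncard ∧
      (k = 0 → SchrodingerWave.negativeIndex L = 1)) ∧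
    (Submodule.span ℝ {SchrodingerWave.vectorXZero d n} ≤
        (SchrodingerWave.eigenspace L 0).restrictScalars ℝ ∧
      FiniteDimensional ℂ (SchrodingerWave.eigenspace L 0) ∧
      K.Finite ∧
      Module.finrank ℂ (SchrodingerWave.eigenspace L 0) = 1 + K.ncard) := by
  open SchrodingerWave in
  intro S L c A B K
  have hn0 : 0 < n := by omega
  have hκ : 0 < kappa σ₂ := kappa_pos hn0 hσ₂_riesz hσ₂_fourier
  have hS : ∫ z, S z * S z = (kappa σ₂ : ℂ) := integral_invSqrtLaplacian_mul_self σ₂ hσ₂_riesz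
  set N : (Fin d → ℤ) → ℂ := fun m => (2 * Real.pi : ℂ) ^ d * c m with hN
  -- Written with a norm so that nonnegativity is visible; it agrees with the squared complex
  -- coefficient because `N m` is real.
  let T : (Fin d → ℤ) → ℝ := fun m => (γ * ‖N m‖) ^ 2 * kappa σ₂
  have hc : ∀ m, (starRingEnd ℂ) (N m) = N m := fun m => by
    rw [hN]
    simp only [map_mul, map_pow, Complex.conj_ofReal, Complex.conj_ofNat]
    rw [conj_coeff_of_even hσ₁_even]
  have hT : ∀ m, ((γ : ℂ) * ((2 * Real.pi : ℂ) ^ d * coeff (fun x => (σ₁ x : ℂ)) m)) ^ 2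
      * (kappa σ₂ : ℂ) = T m := fun m => by
    have h1 : N m ^ 2 = ((‖N m‖ ^ 2 : ℝ) : ℂ) := by
      rw [← Complex.normSq_eq_norm_sq, ← Complex.mul_conj, hc, pow_two]
    change ((γ : ℂ) * N m) ^ 2 * (kappa σ₂ : ℂ) = T m
    rw [mul_pow, h1]
    simp only [T]
    push_cast
    ring
  have hT0 : ∀ m, 0 ≤ T m := fun m => by positivity
  -- The coefficient is at most the `L¹` norm of `σ₁`, so this is the smallness condition divided by
  -- `4`.
  have hT1 : ∀ m, T m < 1 / 4 := fun m => by
    have h1 : ‖N m‖ ≤ ∫ x, |σ₁ x| := norm_two_pi_pow_mul_coeff_le σ₁ m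
    have h2 : T m ≤ (γ * ∫ x, |σ₁ x|) ^ 2 * kappa σ₂ := by
      simp only [T]
      gcongr
    rw [mul_pow] at h2
    linarith
  have hTc : ∀ m, T m = 0 ↔ c m = 0 := fun m => by
    simp [T, hN, hκ.ne', hγ.ne', Real.pi_ne_zero]
  -- The zeroth coefficient is the mean of `σ₁`, which is nonzero.
  have hT00 : 0 < T 0 := by
    refine lt_of_le_of_ne (hT0 0) (Ne.symm fun h => hσ₁_mean ?_)
    rw [hTc] at h
    have h1 := coeff_ofReal_zero σ₁
    rw [show coeff (fun x => (σ₁ x : ℂ)) 0 = 0 from h, eq_comm, mul_eq_zero,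
      or_iff_right (inv_ne_zero (two_pi_pow_ne_zero d))] at h1
    exact_mod_cast h1
  obtain ⟨hfin, hindex⟩ :=
    negativeEigenvalues_finite_and_negativeIndex (k := k) hS hT hT0 hT1 hT00
  have hA : A.Finite := (finite_sq_sub_nonpos k).subset fun m hm => hm.2.1.le
  have hB : B.Finite := (finite_sq_sub_nonpos k).subset fun m hm => hm.2.1
  have hK : K.Finite := (finite_sq_sub_nonpos k).subset fun m hm => hm.2.1.le
  have hidx : negativeIndex L = 1 + A.ncard + B.ncard := by
    have hmodes := negativeModes_eq (k := k) hT0 hT1 hT00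
    simp only [hTc, ne_eq] at hmodes
    have hdisj : Disjoint A B := Set.disjoint_left.mpr fun m h1 h2 => h2.2.2 h1.2.2
    refine hindex.trans ?_
    rw [hmodes]
    change (insert 0 (A ∪ B)).ncard = _
    rw [Set.ncard_insert_of_notMem (fun h => h.elim (fun h => h.1 rfl) fun h => h.1 rfl)
      (hA.union hB), Set.ncard_union_eq hdisj hA hB]
    ring
  refine ⟨essentialSpectrum_operatorL hn0 hS hT hT0 hT1,
    ⟨hfin, fun μ hμ => finiteDimensional_eigenspace hS hT hT0 hT1 (ofReal_ne_half hμ.1.le),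
      hA, hB, hidx, fun hk => ?_⟩, ?_, finiteDimensional_eigenspace hS hT hT0 hT1 (by norm_num),
    hK, ?_⟩
  -- For `k = 0` both sets would require `m⁴ ≤ 0` with `m ≠ 0`.
  · have hpos : ∀ m : Fin d → ℤ, m ≠ 0 → ¬ (m ⬝ᵥ m) ^ 2 - 4 * (k ⬝ᵥ m) ^ 2 ≤ 0 := by
      intro m hm h
      have h1 := one_le_dotProduct_self hm
      rw [hk, zero_dotProduct] at h
      nlinarith
    have hA0 : A = ∅ := Set.eq_empty_of_forall_notMem fun m hm => hpos m hm.1 hm.2.1.le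
    have hB0 : B = ∅ := Set.eq_empty_of_forall_notMem fun m hm => hpos m hm.1 hm.2.1
    rw [hidx, hA0, hB0, Set.ncard_empty]
  · rw [Submodule.span_singleton_le_iff_mem]
    exact vectorXZero_mem_kernel hS hT
  · refine (finrank_kernel (k := k) hS hT hT0 hT1 hT00).trans ?_
    have hker := symD_zero_eq_zero (k := k) hT0 hT1
    simp only [hTc, ne_eq] at hker
    rw [hker]
    change (insert 0 K).ncard = _
    rw [Set.ncard_insert_of_notMem (fun h => h.1 rfl) hK, add_comm]
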